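/- **Parameters.** Let $\lambda_m,\lambda_d>0$ be the densities of base stations and of D2D helpers, $\eta=\lambda_d/\lambda_m$, $\alpha>2$ the path-loss exponent, $P_d>0$ the D2D transmit power, $\sigma^2\ge 0$ the noise power, $\tau_d>0$ the SINR threshold, $\zeta\ge0$ the Zipf exponent, $L$ the library size, $C_d\ge1$ the number of memory slots of a helper, $k\ge1$ and $c\in\{1,\dots,L\}$ the requested content. Put $\mathrm{pop}(c)=c^{-\zeta}/\sum_{l=1}^L l^{-\zeta}$, $h_d(c)=1-(1-\mathrm{pop}(c))^{C_d}$, $\tilde\lambda_m=\bigl(1-(1+\eta/3.5)^{-3.5}\bigr)\lambda_m$, $s_d(r)=\tau_d r^\alpha$, $\bar\alpha=1-2/\alpha$, and $$f_Q(q)=2\pi\tilde\lambda_m q\,e^{-\tilde\lambda_m\pi q^2},\qquad \delta_d(s,\alpha)=\int_0^\infty q^{-(\alpha-2)}\,{}_2F_1\bigl(1,\bar\alpha;1+\bar\alpha;-sq^{-\alpha}\bigr)f_Q(q)\,dq ,$$ where ${}_2F_1$ is the (analytically continued) Gauss hypergeometric function, given by Euler's integral. **Model.** The typical user is at the origin.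 Its cell contains $N_d$ helpers at random positions, with $$\mathbb P[N_d=j]=\frac{3.5^{3.5}\,\Gamma(j+3.5)\,\eta^j}{\Gamma(3.5)\,j!\,(\eta+3.5)^{j+3.5}},\qquad j\ge 0.$$ When $N_d\ge i$, $R_i$ is the distance from the origin to the $i$th nearest helper in the cell. Given $N_d\ge i$, $R_i$ has a density $f_{R_i}$ on $(0,\infty)$, for each $i=1,\dots,k$. Each memory slot of each helper independently holds a content drawn from $\mathrm{pop}$. Under the nearest selection scheme (NS), the user is served by the nearest of the (at most $k$) nearest helpers in the cell that holds $c$. Under the uniform selection scheme (US), one of the $\min(k,N_d)$ nearest helpers in the cell is drawn uniformly and serves the user if it holds $c$. For US assume moreover that the conditional law of $R_i$ given $N_d=n$ is the same for all $n\ge i$, for each $i=1,\dots,k$. The interferers are modelled by a homogeneous Poisson point process $\Phi$ on $\mathbb R^2$ with intensity $\tilde\lambda_m$, those within a guard radius $Q$ of density $f_Q$ being silent. With unit-mean exponential fadings $h_i$ (of the link to the $i$th nearest helper) and $g_z$, $z\in\Phi$ (i.i.d.), put $$I_d=\sum_{z\in\Phi,\ \|z\|>Q}g_z\|z\|^{-\alpha},\qquad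 \mathrm{SINR}_{d,i}=\frac{h_iR_i^{-\alpha}}{\sigma^2/P_d+I_d}.$$ The helper geometry, the cached contents, the uniform draws, the family $(h_i)$, $Q$, $\Phi$ and the family $(g_z)$ are independent. Let $\Gamma_{d,i}=\mathbb P[\mathrm{SINR}_{d,i}\ge\tau_d\mid N_d\ge i]$ and, for $\Pi\in\{NS,US\}$, let $\Gamma_{d,\Pi}^{(k)}(c)$ be the conditional probability, given that the user is served in D2D mode (i.e. by some helper), that the SINR on the serving link is at least $\tau_d$. **Claim.** Let $\Pi\in\{NS,US\}$. (1) For $1\le i\le k$ the probability that the user is served by the $i$th nearest helper is $p^{(k)}_{d,\Pi}(i,c)$, where $$p_{d,NS}^{(k)}(i,c)=\frac{343}{30}\sqrt{\frac{14}{\pi}}\,\frac{\Gamma(i+3.5)\,\eta^i\,{}_2F_1\bigl(1,i+3.5;i+1;\frac{\eta}{\eta+3.5}\bigr)}{i!\,(\eta+3.5)^{i+3.5}}\,(1-h_d(c))^{i-1}h_d(c),$$ $$p_{d,US}^{(k)}(i,c)=h_d(c)\Biggl[\frac{343}{30}\sqrt{\frac{14}{\pi}}\,\frac{\Gamma(k+4.5)\,\eta^{k+1}\,{}_2F_1\bigl(1,k+4.5;k+2;\frac{\eta}{\eta+3.5}\bigr)}{k\,(k+1)!\,(\eta+3.5)^{k+4.5}}+\sum_{j=0}^{k-i}\frac{3.5^{3.5}\,\Gamma(i+j+3.5)\,\eta^{i+j}}{\Gamma(3.5)\,(i+j)\,(i+j)!\,(\eta+3.5)^{i+j+3.5}}\Biggr].$$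 If it is positive, the conditional probability of $\mathrm{SINR}_{d,i}\ge\tau_d$ given that the user is served by the $i$th nearest helper equals $\Gamma_{d,i}$. Moreover $\sum_{i=1}^kp^{(k)}_{d,\Pi}(i,c)>0$ and $$\Gamma_{d,\Pi}^{(k)}(c)=\frac{\sum_{i=1}^kp^{(k)}_{d,\Pi}(i,c)\,\Gamma_{d,i}}{\sum_{i=1}^kp^{(k)}_{d,\Pi}(i,c)} .$$ (2) For $1\le i\le k$ put $$\widehat\Gamma_{d,i}=\int_0^\infty\exp\Bigl(-2\pi\frac{s_d(r)\tilde\lambda_m\delta_d(s_d(r),\alpha)}{\alpha-2}\Bigr)\exp\Bigl(-s_d(r)\frac{\sigma^2}{P_d}\Bigr)f_{R_i}(r)\,dr .$$ This integral, and the one defining $\delta_d(s,\alpha)$ for each $s>0$, converge absolutely, and $\Gamma_{d,i}\approx\widehat\Gamma_{d,i}$ in the sense that $$0\le\Gamma_{d,i}-\widehat\Gamma_{d,i}\le\int_0^\infty\min\bigl\{1,\,2\bigl(\pi\tilde\lambda_m\tau_d^{2/\alpha}K_\alpha r^2\bigr)^2\bigr\}\exp\Bigl(-s_d(r)\frac{\sigma^2}{P_d}\Bigr)f_{R_i}(r)\,dr,\qquad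 K_\alpha=\int_0^\infty\frac{v\,dv}{1+v^\alpha}.$$ -/

import Mathlib

open MeasureTheory ProbabilityTheory Set
open scoped ENNReal

noncomputable section

namespace D2D

/-- The plane `ℝ²` with its Euclidean norm; the typical user is at the origin. -/
abbrev Plane : Type := EuclideanSpace ℝ (Fin 2)

/-- Deterministic parameters: densities `lamM`, `lamD` of base stations and D2D helpers, path loss
exponent `α`, D2D transmit power `Pd`, noise power `noise` (the `σ²` of the formulas), D2D SINR
threshold `τ`, Zipf exponent `ζ`, library size `L`, number `Cd` of memory slots of a helper. -/
structure Params where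
  lamM : ℝ
  lamD : ℝ
  α : ℝ
  Pd : ℝ
  noise : ℝ
  τ : ℝ
  ζ : ℝ
  L : ℕ
  Cd : ℕ
  lamM_pos : 0 < lamM
  lamD_pos : 0 < lamD
  two_lt_α : 2 < α
  Pd_pos : 0 < Pd
  noise_nonneg : 0 ≤ noise
  τ_pos : 0 < τ
  ζ_nonneg : 0 ≤ ζ
  Cd_pos : 0 < Cd

namespace Params

variable (p : Params)

/-- `η_d = λ_d / λ_m`. -/
def η : ℝ := p.lamD / p.lamM

/-- Zipf popularity of content `c ∈ {1, …, L}`. -/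
def pop (c : ℕ) : ℝ :=
  (∑ l ∈ Finset.Icc 1 p.L, (l : ℝ) ^ (-p.ζ))⁻¹ * (c : ℝ) ^ (-p.ζ)

/-- D2D hit rate `h_d(c)`. -/
def hit (c : ℕ) : ℝ := 1 - (1 - p.pop c) ^ p.Cd

/-- Probability mass function of the number of D2D helpers in the cell. -/
def helperPMF (j : ℕ) : ℝ :=
  (3.5 : ℝ) ^ (3.5 : ℝ) * Real.Gamma (j + 3.5) * p.η ^ j /
    (Real.Gamma 3.5 * (Nat.factorial j : ℝ) * (p.η + 3.5) ^ ((j : ℝ) + 3.5))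

/-- Probability that a cell contains at least one (interfering) helper. -/
def pInt : ℝ := 1 - (1 + p.η / 3.5) ^ (-(3.5 : ℝ))

/-- Intensity of the thinned process of active interferers. -/
def lamT : ℝ := p.pInt * p.lamM

/-- `s_d = τ_d r ^ α`. -/
def sd (r : ℝ) : ℝ := p.τ * r ^ p.α

/-- The (Rayleigh) density of the guard radius `Q`. -/
def fQ (q : ℝ) : ℝ := 2 * Real.pi * p.lamT * q * Real.exp (-(p.lamT * Real.pi * q ^ 2))

end Params

/-- The Gaussian hypergeometric function `₂F₁(a, b; c; z)` for real `0 < b < c` and `z < 1`, by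
Euler's integral. Mathlib's `₂F₁` is the sum of the power series, which says nothing for `z < -1`. -/
def euler2F1 (a b c z : ℝ) : ℝ :=
  Real.Gamma c / (Real.Gamma b * Real.Gamma (c - b)) *
    ∫ t in Ioo (0 : ℝ) 1, t ^ (b - 1) * (1 - t) ^ (c - b - 1) * (1 - z * t) ^ (-a)

namespace Params

variable (p : Params)

/-- `q ^ (-(α - 2)) ₂F₁(1, ᾱ; 1 + ᾱ; -s q ^ (-α))` with `ᾱ = 1 - 2 / α`. -/
def deltaKernel (s q : ℝ) : ℝ :=
  q ^ (-(p.α - 2)) * euler2F1 1 (1 - 2 / p.α) (1 + (1 - 2 / p.α)) (-(s * q ^ (-p.α)))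

/-- `δ_d(s, α)`, the expectation of `deltaKernel s Q`. -/
def delta (s : ℝ) : ℝ := ∫ q in Ioi (0 : ℝ), p.deltaKernel s q * p.fQ q

/-- Integrand of the approximate link coverage, `f` being the density of the link distance. -/
def covIntegrand (f : ℝ → ℝ) (r : ℝ) : ℝ :=
  Real.exp (-(2 * Real.pi * (p.sd r * p.lamT * p.delta (p.sd r) / (p.α - 2)))) *
    Real.exp (-(p.sd r * (p.noise / p.Pd))) * f r

/-- Integrand of the error bound. -/
def errIntegrand (f : ℝ → ℝ) (r : ℝ) : ℝ :=
  min 1 (2 * (Real.pi * p.lamT * p.τ ^ (2 / p.α) *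
      (∫ v in Ioi (0 : ℝ), v / (1 + v ^ p.α)) * r ^ 2) ^ 2) *
    Real.exp (-(p.sd r * (p.noise / p.Pd))) * f r

end Params

/-- Helper selection: nearest helper having the content (`NS`), or a uniformly chosen one (`US`). -/
inductive Scheme
  | NS
  | US

/-- `p_d^{(k)}(i, c)`: probability that a user requesting `c` is served by the `i`-th nearest helper
in the cell. The hypergeometric functions are evaluated at `η / (η + 3.5) ∈ (0, 1)`. -/
def Params.pServe (p : Params) (k i c : ℕ) : Scheme → ℝ
  | .NS => 343 / 30 * √(14 / Real.pi) *
      (Real.Gamma (i + 3.5) * p.η ^ i *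
          ₂F₁ (1 : ℝ) ((i : ℝ) + 3.5) ((i : ℝ) + 1) (p.η / (p.η + 3.5)) /
        ((Nat.factorial i : ℝ) * (p.η + 3.5) ^ ((i : ℝ) + 3.5))) *
      (1 - p.hit c) ^ (i - 1) * p.hit c
  | .US => p.hit c *
      (343 / 30 * √(14 / Real.pi) *
          (Real.Gamma (k + 4.5) * p.η ^ (k + 1) *
              ₂F₁ (1 : ℝ) ((k : ℝ) + 4.5) ((k : ℝ) + 2) (p.η / (p.η + 3.5)) /
            (k * (Nat.factorial (k + 1) : ℝ) * (p.η + 3.5) ^ ((k : ℝ) + 4.5))) +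
        ∑ j ∈ Finset.range (k - i + 1),
          (3.5 : ℝ) ^ (3.5 : ℝ) * Real.Gamma (((i + j : ℕ) : ℝ) + 3.5) * p.η ^ (i + j) /
            (Real.Gamma 3.5 * ((i + j : ℕ) : ℝ) * (Nat.factorial (i + j) : ℝ) *
              (p.η + 3.5) ^ (((i + j : ℕ) : ℝ) + 3.5)))

/-- The points `Z 0, Z 1, …` form a homogeneous Poisson point process of intensity `lam` in the
plane. -/
structure IsHPPP {Ω : Type*} [MeasurableSpace Ω] (P : Measure Ω) (Z : ℕ → Ω → Plane)
    (lam : ℝ) : Prop where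
  measurable : ∀ j, Measurable (Z j)
  count : ∀ A : Set Plane, MeasurableSet A → Bornology.IsBounded A → ∀ n : ℕ,
    P {ω | {j | Z j ω ∈ A}.encard = n} =
      ENNReal.ofReal ((lam * volume.real A) ^ n / (Nat.factorial n : ℝ) *
        Real.exp (-(lam * volume.real A)))
  indep : ∀ (m : ℕ) (A : Fin m → Set Plane), (∀ a, MeasurableSet (A a)) →
    (∀ a, Bornology.IsBounded (A a)) → Pairwise (fun a b => Disjoint (A a) (A b)) →
    iIndepFun (fun a ω => {j | Z j ω ∈ A a}.encard) P

/-- The random quantities seen by the typical user: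
* `N` helpers lie in its cell, at positions `D 0, …, D (N - 1)` (in any order);
* `slot i m` is the content in memory slot `m` of the `i`-th nearest helper, `i = 1, 2, …`;
* `U n` is the rank drawn by the `US` scheme if there are `n` candidates;
* `h i` is the fading of the link to the `i`-th nearest helper;
* `Z j` are the interferers, with fading `g j`, those within the guard radius `Q` being silent. -/
structure Network (Ω : Type*) (p : Params) where
  N : Ω → ℕ
  D : ℕ → Ω → Plane
  slot : ℕ → Fin p.Cd → Ω → ℕ
  U : ℕ → Ω → ℕ
  h : ℕ → Ω → ℝ
  Q : Ω → ℝ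
  Z : ℕ → Ω → Plane
  g : ℕ → Ω → ℝ

namespace Network

variable {Ω : Type*} {p : Params} (X : Network Ω p)

/-- The distance `R_i` to the `i`-th nearest helper in the cell (meaningful if `i ≤ N`). -/
def R (i : ℕ) (ω : Ω) : ℝ :=
  sInf {r : ℝ | 0 ≤ r ∧ i ≤ {j | j < X.N ω ∧ ‖X.D j ω‖ ≤ r}.ncard}

/-- The event that there are at least `i` helpers in the cell. -/
def atLeast (i : ℕ) : Set Ω := {ω | i ≤ X.N ω}

/-- The interference `I_d` (over `P_d`). -/
def interference (ω : Ω) : ℝ≥0∞ :=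
  open Classical in
  ∑' j, if X.Q ω < ‖X.Z j ω‖ then ENNReal.ofReal (X.g j ω * ‖X.Z j ω‖ ^ (-p.α)) else 0

/-- The SINR on the link to the `i`-th nearest helper. -/
def SINR (i : ℕ) (ω : Ω) : ℝ≥0∞ :=
  ENNReal.ofReal (X.h i ω * X.R i ω ^ (-p.α)) /
    (ENNReal.ofReal (p.noise / p.Pd) + X.interference ω)

/-- The event that the link to the `i`-th nearest helper is in coverage. -/
def linkCovered (i : ℕ) : Set Ω := {ω | ENNReal.ofReal p.τ ≤ X.SINR i ω}

/-- The `i`-th nearest helper stores content `c`. -/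
def Has (i c : ℕ) (ω : Ω) : Prop := ∃ m, X.slot i m ω = c

/-- The event that the user, requesting `c`, is served by the `i`-th nearest helper when the `k`
nearest helpers in the cell are candidates. -/
def served (k c i : ℕ) : Scheme → Set Ω
  | .NS => {ω | 1 ≤ i ∧ i ≤ min k (X.N ω) ∧ X.Has i c ω ∧ ∀ j, 1 ≤ j → j < i → ¬ X.Has j c ω}
  | .US => {ω | 1 ≤ i ∧ i ≤ min k (X.N ω) ∧ X.U (min k (X.N ω)) ω = i ∧ X.Has i c ω}

/-- The event that the user is served in D2D mode. -/
def d2dMode (k c : ℕ) (S : Scheme) : Set Ω := {ω | ∃ i, ω ∈ X.served k c i S}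

/-- The event that the user is served in D2D mode and the serving link is in coverage. -/
def d2dCovered (k c : ℕ) (S : Scheme) : Set Ω :=
  {ω | ∃ i, ω ∈ X.served k c i S ∧ ω ∈ X.linkCovered i}

variable [MeasurableSpace Ω] (P : Measure Ω)

/-- Coverage probability `Γ_{d,i}` of the link to the `i`-th nearest helper (which has to exist). -/
def linkCov (i : ℕ) : ℝ := (cond P (X.atLeast i)).real (X.linkCovered i)

/-- Coverage probability given that the user is served in D2D mode. -/
def d2dCov (k c : ℕ) (S : Scheme) : ℝ :=
  (cond P (X.d2dMode k c S)).real (X.d2dCovered k c S)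

/-- The laws of the random quantities of the network. The joint law of the number and the positions
of the helpers in the cell is restricted only by the law of their number. -/
structure IsModel : Prop where
  measurable_N : Measurable X.N
  measurable_D : ∀ j, Measurable (X.D j)
  measurable_slot : ∀ i m, Measurable (X.slot i m)
  measurable_U : ∀ n, Measurable (X.U n)
  measurable_h : ∀ i, Measurable (X.h i)
  measurable_Q : Measurable X.Q
  measurable_g : ∀ j, Measurable (X.g j)
  law_N : ∀ j, P {ω | X.N ω = j} = ENNReal.ofReal (p.helperPMF j)
  law_slot : ∀ i m, ∀ c ∈ Finset.Icc 1 p.L, P {ω | X.slot i m ω = c} = ENNReal.ofReal (p.pop c)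
  law_U : ∀ n, ∀ i ∈ Finset.Icc 1 n, P {ω | X.U n ω = i} = (n : ℝ≥0∞)⁻¹
  law_h : ∀ i, P.map (X.h i) = expMeasure 1
  law_Q : P.map X.Q =
    (volume.restrict (Ioi (0 : ℝ))).withDensity fun q => ENNReal.ofReal (p.fQ q)
  law_Z : IsHPPP P X.Z p.lamT
  law_g : ∀ j, P.map (X.g j) = expMeasure 1
  indep_slot : iIndepFun (fun im : ℕ × Fin p.Cd => X.slot im.1 im.2) P
  indep_g : iIndepFun X.g P
  /-- Independence of the helper geometry, the cached contents, the drawn ranks, the fading of the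
  D2D links, the guard radius, the interferers, and their fading. -/
  indep : iIndep
    ![MeasurableSpace.comap X.N inferInstance ⊔ ⨆ j, MeasurableSpace.comap (X.D j) inferInstance,
      ⨆ im : ℕ × Fin p.Cd, MeasurableSpace.comap (X.slot im.1 im.2) inferInstance,
      ⨆ n, MeasurableSpace.comap (X.U n) inferInstance,
      ⨆ i, MeasurableSpace.comap (X.h i) inferInstance,
      MeasurableSpace.comap X.Q inferInstance,
      ⨆ j, MeasurableSpace.comap (X.Z j) inferInstance,
      ⨆ j, MeasurableSpace.comap (X.g j) inferInstance] P

end Network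

end D2D

end

/-! The proof has two largely separate strands.

Serving versus coverage. Coverage of the link of rank `i` is determined by the helper geometry, the
fadings, the guard radius and the interferers. The contents and the uniform draws are independent of
all of these. Under NS, being served at rank `i` involves the geometry only through `i ≤ N`, so
conditioning on it gives the same coverage as conditioning on `atLeast i`. Under US the draw also
depends on `min k N`. The event is therefore sliced by the value of `N`, and the hypothesis on the
conditional law of `R i` makes every slice have the same coverage. The serving probabilities reduce
to tails of the law of `N`, which are hypergeometric series, and d2d coverage is a sum over disjoint
ranks.

Link coverage. For a link of length `r`, the exponential tail of the fading turns coverage into the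
noise factor times the Laplace transform of the interference at `s = τ r^α`. With guard radius `q`,
averaging the interferers' fadings and then applying the Laplace functional of the Poisson process
gives `exp (-Λ(s, q))`, where `Λ` is `laplaceExponent`. A substitution in Euler's integral shows
that the kernel of `δ_d` is a constant multiple of `Λ`. Hence the approximation replaces `E[exp
(-Λ(s, Q))]` by `exp (-E[Λ(s, Q)])`. Jensen's inequality gives its sign. Dropping the guard radius
bounds `Λ` by `2 π λ̃ K s^(2/α)`, and a second order bound on the exponential then controls the gap.
-/

noncomputable section

namespace D2D

open Filter Topology

/-! ### Laplace functional of a homogeneous Poisson process -/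

section

/-- The function `x ↦ exp (-x)` on `[0, ∞]`, with `exp (-∞) = 0`. -/
def expNeg (x : ℝ≥0∞) : ℝ≥0∞ := EReal.exp (-(x : EReal))

theorem expNeg_ofReal {r : ℝ} (hr : 0 ≤ r) :
    expNeg (ENNReal.ofReal r) = ENNReal.ofReal (Real.exp (-r)) := by
  rw [expNeg, EReal.coe_ennreal_ofReal, max_eq_left hr, ← EReal.coe_neg, EReal.exp_coe]

@[simp] theorem expNeg_zero : expNeg 0 = 1 := by simp [expNeg]

@[simp] theorem expNeg_top : expNeg ⊤ = 0 := by simp [expNeg]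

theorem expNeg_antitone : Antitone expNeg := fun x y h => by
  unfold expNeg
  exact EReal.exp_monotone (EReal.neg_le_neg_iff.2 (by exact_mod_cast h))

theorem expNeg_le_one (x : ℝ≥0∞) : expNeg x ≤ 1 := by
  simpa using expNeg_antitone (zero_le : 0 ≤ x)

/-- Continuity holds at `⊤` too, so limits can be taken inside random series without first showing
that they are finite. -/
theorem continuous_expNeg : Continuous expNeg :=
  ENNReal.continuous_exp.comp (continuous_neg.comp continuous_coe_ennreal_ereal)

theorem measurable_expNeg : Measurable expNeg := continuous_expNeg.measurable

theorem expNeg_add (x y : ℝ≥0∞) : expNeg (x + y) = expNeg x * expNeg y := by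
  simp only [expNeg, EReal.exp_neg, EReal.coe_ennreal_add, EReal.exp_add]
  have h : ∀ z : ℝ≥0∞, EReal.exp (z : EReal) ≠ 0 := fun z => by simp
  exact ENNReal.mul_inv (Or.inl (h x)) (Or.inr (h y))

theorem expNeg_sum {ι : Type*} (s : Finset ι) (f : ι → ℝ≥0∞) :
    expNeg (∑ i ∈ s, f i) = ∏ i ∈ s, expNeg (f i) := by
  classical
  induction s using Finset.induction_on with
  | empty => simp
  | insert a s ha ih => rw [Finset.sum_insert ha, Finset.prod_insert ha, expNeg_add, ih]

/-- This is the exponential series at `μ exp (-t)`. The case `t = 0` says that the Poisson weights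
have total mass one. -/
theorem tsum_poisson_expNeg {μ t : ℝ} (hμ : 0 ≤ μ) (ht : 0 ≤ t) :
    ∑' n : ℕ, expNeg (ENNReal.ofReal t * n) *
        ENNReal.ofReal (μ ^ n / (Nat.factorial n : ℝ) * Real.exp (-μ)) =
      expNeg (ENNReal.ofReal μ * (1 - expNeg (ENNReal.ofReal t))) := by
  have key : ∀ n : ℕ, expNeg (ENNReal.ofReal t * n) *
        ENNReal.ofReal (μ ^ n / (Nat.factorial n : ℝ) * Real.exp (-μ)) =
      ENNReal.ofReal ((μ * Real.exp (-t)) ^ n / (Nat.factorial n : ℝ) * Real.exp (-μ)) := by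
    intro n
    rw [← ENNReal.ofReal_natCast, ← ENNReal.ofReal_mul ht, expNeg_ofReal (by positivity),
      ← ENNReal.ofReal_mul (Real.exp_pos _).le, mul_pow, ← Real.exp_nat_mul]
    congr 1
    rw [show -(t * n) = n * -t by ring]
    ring
  have hs : HasSum (fun n : ℕ => (μ * Real.exp (-t)) ^ n / (Nat.factorial n : ℝ) * Real.exp (-μ))
      (Real.exp (μ * Real.exp (-t)) * Real.exp (-μ)) := by
    refine HasSum.mul_right _ ?_
    rw [Real.exp_eq_exp_ℝ]
    exact NormedSpace.expSeries_div_hasSum_exp _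
  have h1 : Real.exp (-t) ≤ 1 := by simpa using ht
  simp_rw [key]
  rw [← ENNReal.ofReal_tsum_of_nonneg (fun n => by positivity) hs.summable, hs.tsum_eq,
    expNeg_ofReal ht, ← ENNReal.ofReal_one, ← ENNReal.ofReal_sub _ (Real.exp_pos _).le,
    ← ENNReal.ofReal_mul hμ, expNeg_ofReal (mul_nonneg hμ (by linarith)), ← Real.exp_add]
  congr 2
  ring

variable {Ω : Type*} [MeasurableSpace Ω] {P : Measure Ω}

/-- Laplace transform of a Poisson variable. -/
theorem lintegral_expNeg_poisson [IsProbabilityMeasure P] {M : Ω → ℕ∞} (hM : Measurable M)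
    {μ : ℝ} (hμ : 0 ≤ μ)
    (hlaw : ∀ n : ℕ, P {ω | M ω = n} =
      ENNReal.ofReal (μ ^ n / (Nat.factorial n : ℝ) * Real.exp (-μ)))
    {a : ℝ≥0∞} (ha : a ≠ ⊤) :
    ∫⁻ ω, expNeg (a * (M ω : ℝ≥0∞)) ∂P = expNeg (ENNReal.ofReal μ * (1 - expNeg a)) := by
  have hms : ∀ n : ℕ, MeasurableSet {ω | M ω = n} := fun n => hM (measurableSet_singleton _)
  have hdisj : Pairwise (Function.onFun Disjoint fun n : ℕ => {ω | M ω = n}) := by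
    intro m n hmn
    refine Set.disjoint_left.2 fun ω h1 h2 => hmn ?_
    simp only [mem_ofPred_eq] at h1 h2
    exact_mod_cast h1.symm.trans h2
  -- The count takes values in `ℕ∞`, but its prescribed masses at finite values already add up to
  -- one, so the value `⊤` is null.
  have hone : P (⋃ n : ℕ, {ω | M ω = n}) = 1 := by
    rw [measure_iUnion hdisj hms]
    simp_rw [hlaw]
    simpa using tsum_poisson_expNeg hμ le_rfl
  have hae : ∀ᵐ ω ∂P, ω ∈ ⋃ n : ℕ, {ω | M ω = n} :=
    (mem_ae_iff_prob_eq_one (MeasurableSet.iUnion hms)).2 hone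
  rw [← setLIntegral_univ, ← setLIntegral_congr (s := ⋃ n : ℕ, {ω | M ω = n})
    (eventuallyEq_univ.2 hae), lintegral_iUnion hms hdisj]
  have : ∀ n : ℕ, ∫⁻ ω in {ω | M ω = n}, expNeg (a * (M ω : ℝ≥0∞)) ∂P =
      expNeg (ENNReal.ofReal a.toReal * n) *
        ENNReal.ofReal (μ ^ n / (Nat.factorial n : ℝ) * Real.exp (-μ)) := by
    intro n
    rw [setLIntegral_congr_fun (g := fun _ => expNeg (a * n)) (hms n)
      (fun ω hω => by simp only [mem_ofPred_eq] at hω; simp [hω]), setLIntegral_const, hlaw,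
      ENNReal.ofReal_toReal ha]
  simp_rw [this]
  rw [tsum_poisson_expNeg hμ ENNReal.toReal_nonneg, ENNReal.ofReal_toReal ha]

theorem tsum_indicator_one_eq_encard (S : Set ℕ) :
    ∑' j, S.indicator (fun _ => (1 : ℝ≥0∞)) j = S.encard := by
  rw [← ENNReal.tsum_set_one, tsum_subtype S (fun _ => (1 : ℝ≥0∞))]

/-- Since `φ 0 = 0`, only the nonzero levels contribute. It is used with `φ = id` for the sum over
points and with `φ = 1 - expNeg` for the intensity integral. -/
theorem simpleFunc_comp_eq_sum_indicator {E : Type*} [MeasurableSpace E]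
    (F : SimpleFunc E ℝ≥0∞) (φ : ℝ≥0∞ → ℝ≥0∞) (hφ : φ 0 = 0) (x : E) :
    φ (F x) = ∑ a ∈ F.range.filter (· ≠ 0), φ a * (F ⁻¹' {a}).indicator (fun _ => 1) x := by
  classical
  rw [Finset.sum_filter]
  have : ∀ a ∈ F.range, (if a ≠ 0 then φ a * (F ⁻¹' {a}).indicator (fun _ => (1 : ℝ≥0∞)) x else 0)
      = if a = F x then φ (F x) else 0 := by
    intro a _
    by_cases h : a = F x
    · subst h
      by_cases h0 : F x = 0
      · simp [h0, hφ]
      · simp [h0]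
    · have : x ∉ F ⁻¹' {a} := fun h' => h (by simpa using (show F x = a by simpa using h').symm)
      simp [h, this]
  rw [Finset.sum_congr rfl this]
  simp

theorem IsHPPP.measurable_encard {Z : ℕ → Ω → Plane} {lam : ℝ} (hZ : IsHPPP P Z lam)
    {A : Set Plane} (hA : MeasurableSet A) :
    Measurable fun ω => {j | Z j ω ∈ A}.encard := by
  have h : Measurable fun ω => (({j | Z j ω ∈ A}.encard : ℕ∞) : ℝ≥0∞) := by
    simp_rw [← tsum_indicator_one_eq_encard]
    refine Measurable.tsum fun j => ?_
    exact (measurable_const.indicator hA).comp (hZ.measurable j)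
  refine measurable_to_countable' fun n => ?_
  have := h (measurableSet_singleton (n : ℝ≥0∞))
  convert this using 1
  ext ω
  simp

/-- The sum over the points is a combination of the counts in the nonzero level sets. These sets are
disjoint and bounded, so the counts are independent Poisson variables and the expectation
factorizes. -/
theorem IsHPPP.lintegral_expNeg_simpleFunc [IsProbabilityMeasure P] {Z : ℕ → Ω → Plane} {lam : ℝ}
    (hlam : 0 ≤ lam) (hZ : IsHPPP P Z lam) (F : SimpleFunc Plane ℝ≥0∞) (hF : ∀ x, F x ≠ ⊤)
    (hB : Bornology.IsBounded (F ⁻¹' {0})ᶜ) :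
    ∫⁻ ω, expNeg (∑' j, F (Z j ω)) ∂P =
      expNeg (ENNReal.ofReal lam * ∫⁻ z, (1 - expNeg (F z))) := by
  classical
  set T := F.range.filter (· ≠ 0) with hT
  set A : Fin T.card → Set Plane := fun a => F ⁻¹' {(T.equivFin.symm a : ℝ≥0∞)} with hA
  have hAm : ∀ a, MeasurableSet (A a) := fun a => F.measurableSet_preimage _
  have hT0 : ∀ a : T, (a : ℝ≥0∞) ≠ 0 ∧ (a : ℝ≥0∞) ≠ ⊤ := by
    rintro ⟨a, ha⟩
    simp only [hT, Finset.mem_filter, SimpleFunc.mem_range, mem_range] at ha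
    obtain ⟨⟨x, rfl⟩, h0⟩ := ha
    exact ⟨h0, hF x⟩
  have hAb : ∀ a, Bornology.IsBounded (A a) := fun a => hB.subset fun x hx => by
    simp only [hA, mem_preimage, mem_singleton_iff] at hx
    simp only [mem_compl_iff, mem_preimage, mem_singleton_iff, hx]
    exact (hT0 _).1
  have hAd : Pairwise fun a b => Disjoint (A a) (A b) := by
    intro a b hab
    refine Set.disjoint_left.2 fun x h1 h2 => hab ?_
    simp only [hA, mem_preimage, mem_singleton_iff] at h1 h2
    exact T.equivFin.symm.injective (Subtype.ext (h1.symm.trans h2))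
  have hsum : ∀ (f : ℝ≥0∞ → ℝ≥0∞), ∑ a ∈ T, f a = ∑ a : Fin T.card, f (T.equivFin.symm a) := by
    intro f
    rw [← Finset.sum_coe_sort T f, ← T.equivFin.symm.sum_comp]
  have hleft : ∀ ω, expNeg (∑' j, F (Z j ω)) = ∏ a : Fin T.card,
      expNeg ((T.equivFin.symm a : ℝ≥0∞) * ({j | Z j ω ∈ A a}.encard : ℝ≥0∞)) := by
    intro ω
    rw [← expNeg_sum]
    congr 1
    calc ∑' j, F (Z j ω)
        = ∑' j, ∑ a ∈ T, a * (F ⁻¹' {a}).indicator (fun _ => 1) (Z j ω) :=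
          tsum_congr fun j => simpleFunc_comp_eq_sum_indicator F id rfl (Z j ω)
      _ = ∑ a ∈ T, a * ∑' j, (F ⁻¹' {a}).indicator (fun _ => 1) (Z j ω) := by
          rw [Summable.tsum_finsetSum fun _ _ => ENNReal.summable]
          simp_rw [ENNReal.tsum_mul_left]
      _ = ∑ a : Fin T.card, (T.equivFin.symm a : ℝ≥0∞) *
            ({j | Z j ω ∈ A a}.encard : ℝ≥0∞) := by
          rw [hsum fun a => a * ∑' j, (F ⁻¹' {a}).indicator (fun _ => 1) (Z j ω)]
          refine Finset.sum_congr rfl fun a _ => ?_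
          rw [← tsum_indicator_one_eq_encard]
          rfl
  have hright : ∫⁻ z, (1 - expNeg (F z)) =
      ∑ a : Fin T.card, (1 - expNeg (T.equivFin.symm a : ℝ≥0∞)) * volume (A a) := by
    rw [lintegral_congr fun z => simpleFunc_comp_eq_sum_indicator F (fun x => 1 - expNeg x)
      (by simp) z]
    rw [lintegral_finsetSum _ fun a _ => (measurable_const.indicator
      (F.measurableSet_preimage _)).const_mul _]
    rw [hsum fun a => ∫⁻ z, (1 - expNeg a) * (F ⁻¹' {a}).indicator (fun _ => 1) z]
    refine Finset.sum_congr rfl fun a _ => ?_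
    rw [lintegral_const_mul _ (measurable_const.indicator (F.measurableSet_preimage _)),
      lintegral_indicator_const (F.measurableSet_preimage _), one_mul]
  have hind := (hZ.indep T.card A hAm hAb hAd).comp
    (fun a n => expNeg ((T.equivFin.symm a : ℝ≥0∞) * (n : ℝ≥0∞))) (fun _ => measurable_from_top)
  have hprod := lintegral_prod_eq_prod_lintegral_of_indepFun Finset.univ _ hind
    (fun a => (measurable_from_top (f := fun n : ℕ∞ =>
      expNeg ((T.equivFin.symm a : ℝ≥0∞) * (n : ℝ≥0∞)))).comp (hZ.measurable_encard (hAm a)))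
  simp only [Function.comp_apply] at hprod
  simp_rw [hleft]
  rw [hprod, hright, Finset.mul_sum, expNeg_sum]
  refine Finset.prod_congr rfl fun a _ => ?_
  rw [lintegral_expNeg_poisson (hZ.measurable_encard (hAm a))
    (mul_nonneg hlam measureReal_nonneg) (hZ.count (A a) (hAm a) (hAb a)) (hT0 _).2,
    ENNReal.ofReal_mul hlam, measureReal_def, ENNReal.ofReal_toReal (hAb a).measure_lt_top.ne]
  congr 1
  ring

/-- Laplace functional of a homogeneous Poisson point process. -/
theorem IsHPPP.lintegral_expNeg_tsum [IsProbabilityMeasure P] {Z : ℕ → Ω → Plane} {lam : ℝ}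
    (hlam : 0 ≤ lam) (hZ : IsHPPP P Z lam) {v : Plane → ℝ≥0∞} (hv : Measurable v) :
    ∫⁻ ω, expNeg (∑' j, v (Z j ω)) ∂P =
      expNeg (ENNReal.ofReal lam * ∫⁻ z, (1 - expNeg (v z))) := by
  have hball : ∀ n : ℕ, MeasurableSet (Metric.closedBall (0 : Plane) n) :=
    fun n => measurableSet_closedBall
  -- Cutting the approximations off outside growing balls keeps them increasing to `v` and gives
  -- them bounded support, as the simple case requires.
  set F : ℕ → SimpleFunc Plane ℝ≥0∞ := fun n =>
    (SimpleFunc.eapprox v n).restrict (Metric.closedBall 0 n) with hFdef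
  have hFa : ∀ n x, F n x =
      (Metric.closedBall (0 : Plane) n).indicator (SimpleFunc.eapprox v n) x := fun n x =>
    SimpleFunc.restrict_apply _ (hball n) x
  have hFmono : ∀ x, Monotone fun n => F n x := by
    intro x m n hmn
    simp only [hFa]
    refine (indicator_le_indicator (SimpleFunc.monotone_eapprox v hmn x)).trans
      (indicator_le_indicator_of_subset (Metric.closedBall_subset_closedBall (by exact_mod_cast hmn))
        (fun _ => zero_le) x)
  have hFlim : ∀ x, Tendsto (fun n => F n x) atTop (𝓝 (v x)) := by
    intro x
    have h1 : Tendsto (fun n => SimpleFunc.eapprox v n x) atTop (𝓝 (v x)) := by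
      rw [← SimpleFunc.iSup_eapprox_apply hv x]
      exact tendsto_atTop_iSup fun m n hmn => SimpleFunc.monotone_eapprox v hmn x
    refine h1.congr' ?_
    obtain ⟨N, hN⟩ := exists_nat_ge ‖x‖
    filter_upwards [eventually_ge_atTop N] with n hn
    rw [hFa, indicator_of_mem]
    simpa using hN.trans (by exact_mod_cast hn)
  have hFtop : ∀ n x, F n x ≠ ⊤ := by
    intro n x
    rw [hFa]
    exact ((indicator_le_self' (fun _ _ => zero_le) x).trans_lt
      (SimpleFunc.eapprox_lt_top v n x)).ne
  have hFb : ∀ n, Bornology.IsBounded (F n ⁻¹' {0})ᶜ := by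
    intro n
    refine (Metric.isBounded_closedBall (x := (0 : Plane)) (r := n)).subset fun x hx => ?_
    by_contra hx'
    exact hx (by simp [hFa, indicator_of_notMem hx'])
  have hL : Tendsto (fun n => ∫⁻ ω, expNeg (∑' j, F n (Z j ω)) ∂P) atTop
      (𝓝 (∫⁻ ω, expNeg (∑' j, v (Z j ω)) ∂P)) := by
    refine tendsto_lintegral_of_dominated_convergence (fun _ => 1) (fun n => ?_)
      (fun n => ae_of_all _ fun ω => expNeg_le_one _) (by simp) (ae_of_all _ fun ω => ?_)
    · exact measurable_expNeg.comp
        (Measurable.tsum fun j => (F n).measurable.comp (hZ.measurable j))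
    · refine (continuous_expNeg.tendsto _).comp ?_
      -- The series is an integral against counting measure, so monotone convergence applies
      -- pointwise in `ω`.
      simp_rw [← lintegral_count]
      exact lintegral_tendsto_of_tendsto_of_monotone
        (fun n => (measurable_of_countable _).aemeasurable)
        (ae_of_all _ fun j => hFmono _) (ae_of_all _ fun j => hFlim _)
  have hR : Tendsto (fun n => expNeg (ENNReal.ofReal lam * ∫⁻ z, (1 - expNeg (F n z)))) atTop
      (𝓝 (expNeg (ENNReal.ofReal lam * ∫⁻ z, (1 - expNeg (v z))))) := by
    refine (continuous_expNeg.tendsto _).comp (ENNReal.Tendsto.const_mul ?_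
      (Or.inr ENNReal.ofReal_ne_top))
    refine lintegral_tendsto_of_tendsto_of_monotone
      (fun n => ((measurable_const.sub (measurable_expNeg.comp (F n).measurable))).aemeasurable)
      (ae_of_all _ fun z m n hmn => tsub_le_tsub_left (expNeg_antitone (hFmono z hmn)) 1)
      (ae_of_all _ fun z => ENNReal.Tendsto.sub tendsto_const_nhds
        ((continuous_expNeg.tendsto _).comp (hFlim z)) (Or.inl ENNReal.one_ne_top))
  refine tendsto_nhds_unique hL (hR.congr fun n => ?_)
  exact (hZ.lintegral_expNeg_simpleFunc hlam (F n) (hFtop n) (hFb n)).symm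

end

/-! ### Radial integrals and the hypergeometric kernel -/

theorem integrableOn_id_div_add_rpow {α s : ℝ} (hα : 2 < α) (hs : 0 < s) :
    IntegrableOn (fun v : ℝ => v / (s + v ^ α)) (Ioi 0) := by
  have hmeas : Measurable fun v : ℝ => v / (s + v ^ α) := by fun_prop
  rw [← Ioc_union_Ioi_eq_Ioi (zero_le_one' ℝ)]
  refine IntegrableOn.union ?_ ?_
  · refine Measure.integrableOn_of_bounded (M := 1 / s) (by simp) hmeas.aestronglyMeasurable ?_
    refine (ae_restrict_iff' measurableSet_Ioc).2 (ae_of_all _ fun v hv => ?_)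
    have h0 : 0 ≤ v ^ α := Real.rpow_nonneg hv.1.le _
    rw [Real.norm_of_nonneg (div_nonneg hv.1.le (by linarith))]
    exact div_le_div₀ zero_le_one hv.2 hs (by linarith)
  -- The integrand is at most `v ^ (1 - α)`, which is integrable at infinity because `α > 2`.
  · refine Integrable.mono' (integrableOn_Ioi_rpow_of_lt (a := 1 - α) (by linarith) one_pos)
      hmeas.aestronglyMeasurable ?_
    refine (ae_restrict_iff' measurableSet_Ioi).2 (ae_of_all _ fun v hv => ?_)
    have hv0 : (0 : ℝ) < v := lt_trans one_pos hv
    have h0 : 0 < v ^ α := Real.rpow_pos_of_pos hv0 _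
    rw [Real.norm_of_nonneg (div_nonneg hv0.le (by linarith)), Real.rpow_sub hv0, Real.rpow_one]
    exact div_le_div_of_nonneg_left hv0.le h0 (by linarith)

/-- The substitution `v = s^(1/α) x` isolates the constant `K_α`. At `s = τ r^α` the power of `s` is
the source of the `r ^ 2` in the error bound. -/
theorem mul_integral_id_div_add_rpow {α s : ℝ} (hα : 0 < α) (hs : 0 < s) :
    s * ∫ v in Ioi (0 : ℝ), v / (s + v ^ α) =
      s ^ (2 / α) * ∫ v in Ioi (0 : ℝ), v / (1 + v ^ α) := by
  set c := s ^ (1 / α) with hc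
  have hc0 : 0 < c := Real.rpow_pos_of_pos hs _
  have hcα : c ^ α = s := by
    rw [hc, ← Real.rpow_mul hs.le, one_div_mul_cancel hα.ne', Real.rpow_one]
  have hc2 : s ^ (2 / α) = c * c := by
    rw [hc, ← Real.rpow_add hs]
    congr 1
    ring
  have h := integral_comp_mul_left_Ioi (fun v : ℝ => v / (s + v ^ α)) 0 hc0
  rw [mul_zero, smul_eq_mul] at h
  have h2 : ∫ x in Ioi (0 : ℝ), c * x / (s + (c * x) ^ α) =
      c / s * ∫ v in Ioi (0 : ℝ), v / (1 + v ^ α) := by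
    rw [← integral_const_mul]
    refine setIntegral_congr_fun measurableSet_Ioi fun x hx => ?_
    have hx0 : (0 : ℝ) < x := hx
    have : 0 < x ^ α := Real.rpow_pos_of_pos hx0 _
    simp only [Real.mul_rpow hc0.le hx0.le, hcα]
    field_simp
  rw [h2] at h
  rw [hc2, (eq_inv_mul_iff_mul_eq₀ hc0.ne').1 h |>.symm]
  field_simp

/-- Substitute `t = x^(-α)`, which carries `(1, ∞)` onto `(0, 1)`, and then `v = q x`. -/
theorem integral_Ioo_rpow_mul_one_add_inv {α s q : ℝ} (hα : 2 < α) (hs : 0 < s) (hq : 0 < q) :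
    ∫ t in Ioo (0 : ℝ) 1, t ^ (-(2 / α)) * (1 + s * q ^ (-α) * t)⁻¹ =
      α * q ^ (α - 2) * ∫ v in Ioi q, v / (s + v ^ α) := by
  set G : ℝ → ℝ := fun t => t ^ (-(2 / α)) * (1 + s * q ^ (-α) * t)⁻¹ with hG
  have hα0 : 0 < α := by linarith
  have h1 : ∫ t in Ioo (0 : ℝ) 1, G t = ∫ t in Ioi (0 : ℝ), (Iio 1).indicator G t := by
    rw [setIntegral_indicator measurableSet_Iio, Ioi_inter_Iio]
  rw [h1, ← integral_comp_rpow_Ioi _ (neg_ne_zero.2 hα0.ne')]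
  have h2 : ∀ x ∈ Ioi (0 : ℝ), (|-α| * x ^ (-α - 1)) • (Iio 1).indicator G (x ^ (-α)) =
      (Ioi 1).indicator
        (fun x => α * q ^ (α - 1) * ((fun v : ℝ => v / (s + v ^ α)) (q * x))) x := by
    intro x hx
    have hx0 : (0 : ℝ) < x := hx
    by_cases h : 1 < x
    · rw [indicator_of_mem (show x ∈ Ioi 1 from h), indicator_of_mem
        (show x ^ (-α) ∈ Iio 1 from Real.rpow_lt_one_of_one_lt_of_neg h (by linarith)),
        abs_neg, abs_of_pos hα0, smul_eq_mul]
      have hxα : 0 < x ^ α := Real.rpow_pos_of_pos hx0 _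
      have hqα : 0 < q ^ α := Real.rpow_pos_of_pos hq _
      simp only [hG]
      rw [← Real.rpow_mul hx0.le, show -α * -(2 / α) = 2 by field_simp, Real.mul_rpow hq.le hx0.le,
        Real.rpow_sub hx0, Real.rpow_neg hx0.le, Real.rpow_neg hq.le, Real.rpow_sub hq,
        Real.rpow_one, Real.rpow_one, Real.rpow_two]
      field_simp
      ring
    · rw [indicator_of_notMem (show x ∉ Ioi 1 from h), indicator_of_notMem, smul_zero]
      rw [mem_Iio, not_lt]
      exact Real.one_le_rpow_of_pos_of_le_one_of_nonpos hx0 (not_lt.1 h) (by linarith)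
  rw [setIntegral_congr_fun measurableSet_Ioi h2, setIntegral_indicator measurableSet_Ioi,
    Ioi_inter_Ioi, max_eq_right zero_le_one, integral_const_mul,
    integral_comp_mul_left_Ioi (fun v : ℝ => v / (s + v ^ α)) 1 hq, mul_one, smul_eq_mul,
    Real.rpow_sub hq, Real.rpow_sub hq,
    Real.rpow_one, Real.rpow_two]
  field_simp

/-- The third hypergeometric parameter exceeds the second by one, so the power of `1 - t` in Euler's
integral disappears. The Gamma quotient equals `1 - 2/α`, which turns the factor `α` of the
substitution into `α - 2`. -/
theorem Params.deltaKernel_eq (p : Params) {s q : ℝ} (hs : 0 < s) (hq : 0 < q) :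
    p.deltaKernel s q = (p.α - 2) * ∫ v in Ioi q, v / (s + v ^ p.α) := by
  have hα := p.two_lt_α
  have hα0 : 0 < p.α := by linarith
  have ha : 0 < 1 - 2 / p.α := by
    rw [sub_pos, div_lt_one hα0]
    exact hα
  have hint : ∀ t : ℝ, t ^ (1 - 2 / p.α - 1) * (1 - t) ^ (1 + (1 - 2 / p.α) - (1 - 2 / p.α) - 1) *
      (1 - -(s * q ^ (-p.α)) * t) ^ (-1 : ℝ) =
      t ^ (-(2 / p.α)) * (1 + s * q ^ (-p.α) * t)⁻¹ := by
    intro t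
    rw [show 1 - 2 / p.α - 1 = -(2 / p.α) by ring,
      show 1 + (1 - 2 / p.α) - (1 - 2 / p.α) - 1 = 0 by ring, Real.rpow_zero, mul_one,
      Real.rpow_neg_one, neg_mul, sub_neg_eq_add]
  unfold Params.deltaKernel euler2F1
  simp_rw [hint]
  rw [integral_Ioo_rpow_mul_one_add_inv hα hs hq, add_comm (1 : ℝ), Real.Gamma_add_one ha.ne',
    add_sub_cancel_left, Real.Gamma_one, Real.rpow_neg hq.le]
  have h1 := (Real.Gamma_pos_of_pos ha).ne'
  have h2 := (Real.rpow_pos_of_pos hq (p.α - 2)).ne'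
  generalize Real.Gamma (1 - 2 / p.α) = γ at h1 ⊢
  field_simp

theorem lintegral_plane_of_norm {f : ℝ → ℝ} (hf : ∀ y, 0 < y → 0 ≤ f y)
    (hi : IntegrableOn (fun y => y * f y) (Ioi 0)) :
    ∫⁻ z : Plane, ENNReal.ofReal (f ‖z‖) =
      ENNReal.ofReal (2 * Real.pi * ∫ y in Ioi (0 : ℝ), y * f y) := by
  have hdim : Module.finrank ℝ Plane = 2 := by simp
  have hint : Integrable fun z : Plane => f ‖z‖ := by
    rw [integrable_fun_norm_addHaar, hdim]
    simpa using hi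
  have hvol : (volume : Measure Plane).real (Metric.ball 0 1) = Real.pi := by
    rw [measureReal_def, EuclideanSpace.volume_ball_fin_two]
    simp [Real.pi_pos.le]
  have h0 : ∀ᵐ z : Plane, 0 ≤ f ‖z‖ := by
    have : ∀ᵐ z : Plane, z ≠ 0 := by simp [ae_iff]
    filter_upwards [this] with z hz using hf _ (norm_pos_iff.2 hz)
  rw [← ofReal_integral_eq_lintegral_ofReal hint h0, integral_fun_norm_addHaar, hdim, hvol]
  congr 1
  simp [mul_assoc]

/-! ### Exponential fading and the Laplace transform of the interference -/

section

theorem lintegral_expMeasure_one {φ : ℝ → ℝ≥0∞} (hφ : Measurable φ) :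
    ∫⁻ x, φ x ∂expMeasure 1 = ∫⁻ x in Ioi 0, ENNReal.ofReal (Real.exp (-x)) * φ x := by
  have hpdf : Measurable (exponentialPDF 1) := (measurable_exponentialPDFReal 1).ennreal_ofReal
  have : expMeasure 1 = volume.withDensity (exponentialPDF 1) := rfl
  rw [this, lintegral_withDensity_eq_lintegral_mul _ hpdf hφ,
    ← lintegral_indicator measurableSet_Ioi]
  have h0 : ∀ᵐ x : ℝ, x ≠ 0 := by simp [ae_iff]
  refine lintegral_congr_ae ?_
  filter_upwards [h0] with x hx
  rcases lt_or_gt_of_ne hx with h | h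
  · rw [indicator_of_notMem (by simpa using h.le), Pi.mul_apply, exponentialPDF_of_neg h, zero_mul]
  · rw [indicator_of_mem (by simpa using h), Pi.mul_apply, exponentialPDF_of_nonneg h.le]
    simp

theorem expMeasure_one_Ici {t : ℝ} (ht : 0 ≤ t) :
    expMeasure 1 (Ici t) = expNeg (ENNReal.ofReal t) := by
  rw [expNeg_ofReal ht, ← lintegral_indicator_one measurableSet_Ici,
    lintegral_expMeasure_one (measurable_one.indicator measurableSet_Ici)]
  have h1 : ∀ x : ℝ, ENNReal.ofReal (Real.exp (-x)) * (Ici t).indicator 1 x =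
      (Ici t).indicator (fun x => ENNReal.ofReal (Real.exp (-x))) x := by
    intro x
    by_cases hx : x ∈ Ici t <;> simp [hx]
  have h2 : (Ici t ∩ Ioi 0 : Set ℝ) =ᵐ[volume] Ioi t := by
    rcases ht.eq_or_lt with rfl | h
    · rw [inter_eq_right.2 Ioi_subset_Ici_self]
      exact Filter.EventuallyEq.rfl
    · have : Ici t ⊆ Ioi 0 := fun x hx => lt_of_lt_of_le h hx
      rw [inter_eq_left.2 this]
      exact Ioi_ae_eq_Ici.symm
  simp_rw [h1]
  rw [setLIntegral_indicator measurableSet_Ici, setLIntegral_congr h2,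
    ← ofReal_integral_eq_lintegral_ofReal (integrableOn_exp_neg_Ioi t)
      (ae_of_all _ fun x => (Real.exp_pos _).le), integral_exp_neg_Ioi]

theorem expMeasure_one_Ioi_zero : expMeasure 1 (Ioi 0) = 1 := by
  have h0 : expMeasure 1 {0} = 0 := by
    have : expMeasure 1 = volume.withDensity (exponentialPDF 1) := rfl
    rw [this]
    exact withDensity_absolutelyContinuous _ _ (by simp)
  have h1 : (Ioi 0 : Set ℝ) = Ici 0 \ {0} := by
    ext x
    simp [lt_iff_le_and_ne, eq_comm]
  rw [h1, measure_sdiff_null h0, expMeasure_one_Ici le_rfl]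
  simp

/-- The value `1 / (1 + b)` is written as `expNeg` of a logarithm so that a product over interferers
becomes a series over points, the form taken by the Poisson Laplace functional. -/
theorem lintegral_expNeg_mul_expMeasure_one {b : ℝ} (hb : 0 ≤ b) :
    ∫⁻ x, expNeg (ENNReal.ofReal x * ENNReal.ofReal b) ∂expMeasure 1 =
      expNeg (ENNReal.ofReal (Real.log (1 + b))) := by
  have hm : Measurable fun x => expNeg (ENNReal.ofReal x * ENNReal.ofReal b) :=
    measurable_expNeg.comp (ENNReal.measurable_ofReal.mul_const _)
  rw [lintegral_expMeasure_one hm, expNeg_ofReal (Real.log_nonneg (by linarith)),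
    Real.exp_neg, Real.exp_log (by linarith)]
  have h1 : ∀ x ∈ Ioi (0 : ℝ), ENNReal.ofReal (Real.exp (-x)) *
      expNeg (ENNReal.ofReal x * ENNReal.ofReal b) =
      ENNReal.ofReal (Real.exp (-(1 + b) * x)) := by
    intro x hx
    have hx0 : (0 : ℝ) ≤ x := le_of_lt hx
    rw [← ENNReal.ofReal_mul hx0, expNeg_ofReal (by positivity),
      ← ENNReal.ofReal_mul (Real.exp_pos _).le, ← Real.exp_add]
    congr 2
    ring
  rw [setLIntegral_congr_fun measurableSet_Ioi h1,
    ← ofReal_integral_eq_lintegral_ofReal (integrableOn_exp_mul_Ioi (by linarith) 0)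
      (ae_of_all _ fun x => (Real.exp_pos _).le), integral_exp_mul_Ioi (by linarith)]
  congr 1
  rw [mul_zero, Real.exp_zero, neg_div_neg_eq, one_div]

/-- The interference at the origin, for path loss exponent `α`, guard radius `q`, interferers at
`z 0, z 1, …` and fading `g`. -/
def interf (α q : ℝ) (z : ℕ → Plane) (g : ℕ → ℝ) : ℝ≥0∞ :=
  ∑' j, if q < ‖z j‖ then ENNReal.ofReal (g j * ‖z j‖ ^ (-α)) else 0

theorem Network.interference_eq {Ω : Type*} {p : Params} (X : Network Ω p) (ω : Ω) :
    X.interference ω = interf p.α (X.Q ω) (fun j => X.Z j ω) (fun j => X.g j ω) := by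
  unfold Network.interference interf
  refine tsum_congr fun j => ?_
  split_ifs <;> rfl

variable {Ω : Type*} [MeasurableSpace Ω] {P : Measure Ω}

/-- Laplace transform of a weighted series of independent unit exponential variables. -/
theorem lintegral_expNeg_tsum_exponential [IsProbabilityMeasure P] {g : ℕ → Ω → ℝ}
    (hgm : ∀ j, Measurable (g j)) (hlaw : ∀ j, P.map (g j) = expMeasure 1)
    (hind : iIndepFun g P) {b : ℕ → ℝ} (hb : ∀ j, 0 ≤ b j) :
    ∫⁻ ω, expNeg (∑' j, ENNReal.ofReal (g j ω) * ENNReal.ofReal (b j)) ∂P =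
      expNeg (∑' j, ENNReal.ofReal (Real.log (1 + b j))) := by
  have hφ : ∀ j, Measurable fun x : ℝ => expNeg (ENNReal.ofReal x * ENNReal.ofReal (b j)) :=
    fun j => measurable_expNeg.comp (ENNReal.measurable_ofReal.mul_const _)
  have hfin : ∀ n, ∫⁻ ω, expNeg (∑ j ∈ Finset.range n,
        ENNReal.ofReal (g j ω) * ENNReal.ofReal (b j)) ∂P =
      expNeg (∑ j ∈ Finset.range n, ENNReal.ofReal (Real.log (1 + b j))) := by
    intro n
    simp_rw [expNeg_sum]
    have h := lintegral_prod_eq_prod_lintegral_of_indepFun (Finset.range n) _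
      (hind.comp (fun j x => expNeg (ENNReal.ofReal x * ENNReal.ofReal (b j))) hφ)
      (fun j => (hφ j).comp (hgm j))
    simp only [Function.comp_apply] at h
    rw [h]
    refine Finset.prod_congr rfl fun j _ => ?_
    rw [← lintegral_expNeg_mul_expMeasure_one (hb j), ← hlaw j, lintegral_map (hφ j) (hgm j)]
  have hL : Tendsto (fun n => ∫⁻ ω, expNeg (∑ j ∈ Finset.range n,
        ENNReal.ofReal (g j ω) * ENNReal.ofReal (b j)) ∂P) atTop
      (𝓝 (∫⁻ ω, expNeg (∑' j, ENNReal.ofReal (g j ω) * ENNReal.ofReal (b j)) ∂P)) := by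
    refine tendsto_lintegral_of_dominated_convergence (fun _ => 1) (fun n => ?_)
      (fun n => ae_of_all _ fun ω => expNeg_le_one _) (by simp) (ae_of_all _ fun ω => ?_)
    · exact measurable_expNeg.comp (Finset.measurable_fun_sum _ fun j _ =>
        (hgm j).ennreal_ofReal.mul_const _)
    · exact (continuous_expNeg.tendsto _).comp (ENNReal.tendsto_nat_tsum _)
  have hR := (continuous_expNeg.tendsto _).comp
    (ENNReal.tendsto_nat_tsum fun j => ENNReal.ofReal (Real.log (1 + b j)))
  exact tendsto_nhds_unique hL (hR.congr fun n => (hfin n).symm)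

/-- Fubini for the product law: one of two independent variables may be frozen while the other is
averaged. Every later conditioning argument has this form. -/
theorem IndepFun.lintegral_prodMk [IsProbabilityMeasure P] {β γ : Type*} [MeasurableSpace β]
    [MeasurableSpace γ] {F : Ω → β} {G : Ω → γ} (h : IndepFun F G P) (hF : Measurable F)
    (hG : Measurable G) {φ : β × γ → ℝ≥0∞} (hφ : Measurable φ) :
    ∫⁻ ω, φ (F ω, G ω) ∂P = ∫⁻ ω, ∫⁻ ω', φ (F ω, G ω') ∂P ∂P := by
  have := Measure.isProbabilityMeasure_map (μ := P) hG.aemeasurable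
  rw [← lintegral_map (f := φ) hφ (hF.prodMk hG),
    (indepFun_iff_map_prod_eq_prod_map_map hF.aemeasurable hG.aemeasurable).1 h,
    lintegral_prod _ hφ.aemeasurable, lintegral_map hφ.lintegral_prod_right' hF]
  exact lintegral_congr fun ω => lintegral_map (hφ.comp measurable_prodMk_left) hG

theorem measurable_interf (α : ℝ) :
    Measurable fun x : ℝ × (ℕ → Plane) × (ℕ → ℝ) => interf α x.1 x.2.1 x.2.2 := by
  unfold interf
  refine Measurable.tsum fun j => Measurable.ite ?_ ?_ measurable_const
  · exact measurableSet_lt (by fun_prop) (by fun_prop)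
  · exact Measurable.ennreal_ofReal (by fun_prop)

/-- Laplace transform of the interference with fixed guard radius. -/
theorem lintegral_expNeg_interf [IsProbabilityMeasure P] {Z : ℕ → Ω → Plane} {g : ℕ → Ω → ℝ}
    {lam α s q : ℝ} (hlam : 0 ≤ lam) (hα : 2 < α) (hs : 0 < s) (hq : 0 < q)
    (hZ : IsHPPP P Z lam) (hgm : ∀ j, Measurable (g j))
    (hlaw : ∀ j, P.map (g j) = expMeasure 1) (hg : iIndepFun g P)
    (hZg : IndepFun (fun ω j => Z j ω) (fun ω j => g j ω) P) :
    ∫⁻ ω, expNeg (ENNReal.ofReal s * interf α q (fun j => Z j ω) (fun j => g j ω)) ∂P =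
      ENNReal.ofReal (Real.exp (-(2 * Real.pi * (s * lam * ∫ v in Ioi q, v / (s + v ^ α))))) := by
  classical
  set B : ℝ → ℝ := fun y => if q < y then s * y ^ (-α) else 0 with hB
  have hBm : Measurable B := Measurable.ite measurableSet_Ioi (by fun_prop) measurable_const
  have hB0 : ∀ y, 0 ≤ B y := by
    intro y
    simp only [hB]
    split_ifs with h
    · exact mul_nonneg hs.le (Real.rpow_nonneg (hq.trans h).le _)
    · exact le_rfl
  have h1 : ∀ (z : ℕ → Plane) (f : ℕ → ℝ), ENNReal.ofReal s * interf α q z f =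
      ∑' j, ENNReal.ofReal (f j) * ENNReal.ofReal (B ‖z j‖) := by
    intro z f
    unfold interf
    rw [← ENNReal.tsum_mul_left]
    refine tsum_congr fun j => ?_
    simp only [hB]
    split_ifs with h
    · have h0 : 0 ≤ ‖z j‖ ^ (-α) := Real.rpow_nonneg (norm_nonneg _) _
      rw [ENNReal.ofReal_mul' h0, ENNReal.ofReal_mul hs.le]
      ring
    · simp
  have hφ : Measurable fun x : (ℕ → Plane) × (ℕ → ℝ) =>
      expNeg (ENNReal.ofReal s * interf α q x.1 x.2) :=
    measurable_expNeg.comp (Measurable.const_mul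
      ((measurable_interf α).comp (measurable_const.prodMk measurable_id)) _)
  rw [IndepFun.lintegral_prodMk hZg (measurable_pi_iff.2 hZ.measurable) (measurable_pi_iff.2 hgm) hφ]
  simp_rw [h1]
  -- With the points frozen, averaging the fadings leaves a sum over the points of a deterministic
  -- function of their norms.
  rw [lintegral_congr fun ω => lintegral_expNeg_tsum_exponential hgm hlaw hg
    (b := fun j => B ‖Z j ω‖) fun j => hB0 _]
  rw [hZ.lintegral_expNeg_tsum hlam (v := fun z => ENNReal.ofReal (Real.log (1 + B ‖z‖)))
    (Measurable.ennreal_ofReal (Real.measurable_log.comp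
      ((hBm.comp measurable_norm).const_add 1)))]
  have h2 : ∀ y, 1 - expNeg (ENNReal.ofReal (Real.log (1 + B y))) =
      ENNReal.ofReal (B y / (1 + B y)) := by
    intro y
    have := hB0 y
    rw [expNeg_ofReal (Real.log_nonneg (by linarith)), Real.exp_neg, Real.exp_log (by linarith),
      ← ENNReal.ofReal_one, ← ENNReal.ofReal_sub _ (by positivity)]
    congr 1
    field_simp
    ring
  -- In polar coordinates the extra factor `y` produces the integrand of the exponent, restricted to
  -- radii beyond the guard radius.
  have h3 : EqOn (fun y => y * (B y / (1 + B y)))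
      ((Ioi q).indicator fun v => s * (v / (s + v ^ α))) (Ioi 0) := by
    intro y hy
    have hy0 : (0 : ℝ) < y := hy
    have hyα : 0 < y ^ α := Real.rpow_pos_of_pos hy0 _
    by_cases h : q < y
    · simp only [hB, if_pos h, indicator_of_mem (show y ∈ Ioi q from h), Real.rpow_neg hy0.le]
      field_simp
      ring
    · simp [hB, if_neg h, indicator_of_notMem (show y ∉ Ioi q from h)]
  have hint : IntegrableOn (fun v : ℝ => s * (v / (s + v ^ α))) (Ioi 0) :=
    (integrableOn_id_div_add_rpow hα hs).const_mul s
  simp_rw [h2]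
  rw [lintegral_plane_of_norm (f := fun y => B y / (1 + B y))
    (fun y _ => div_nonneg (hB0 y) (by have := hB0 y; linarith))
    ((integrableOn_congr_fun h3 measurableSet_Ioi).2 (hint.indicator measurableSet_Ioi)),
    setIntegral_congr_fun measurableSet_Ioi h3, setIntegral_indicator measurableSet_Ioi,
    Ioi_inter_Ioi, max_eq_right hq.le, integral_const_mul, ← ENNReal.ofReal_mul hlam, expNeg_ofReal]
  · congr 3
    ring
  · have : 0 ≤ ∫ v in Ioi q, v / (s + v ^ α) := setIntegral_nonneg measurableSet_Ioi fun v hv => by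
      have hv0 : (0 : ℝ) < v := hq.trans hv
      positivity
    positivity

end

/-! ### Positivity of the parameters and measurability of the network quantities -/

namespace Params

variable (p : Params)

theorem η_pos : 0 < p.η := div_pos p.lamD_pos p.lamM_pos

theorem lamT_pos : 0 < p.lamT := by
  refine mul_pos ?_ p.lamM_pos
  have h := div_pos p.η_pos (show (0 : ℝ) < 3.5 by norm_num)
  have := Real.rpow_lt_one_of_one_lt_of_neg (x := 1 + p.η / 3.5) (z := -3.5)
    (by linarith) (by norm_num)
  unfold pInt
  linarith

theorem lamT_nonneg : 0 ≤ p.lamT := p.lamT_pos.le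

theorem sd_pos {r : ℝ} (hr : 0 < r) : 0 < p.sd r :=
  mul_pos p.τ_pos (Real.rpow_pos_of_pos hr _)

theorem fQ_nonneg {q : ℝ} (hq : 0 ≤ q) : 0 ≤ p.fQ q := by
  have := p.lamT_nonneg
  have := Real.pi_pos
  unfold fQ
  positivity

theorem measurable_fQ : Measurable p.fQ := by
  unfold fQ
  fun_prop

end Params

namespace Network

/-- Rational radii make the event a countable union, which is what measurability needs. If there are
fewer than `i` helpers, the infimum is over the empty set and equals `0`, hence the first disjunct.
-/
theorem R_lt_iff {Ω : Type*} {p : Params} {X : Network Ω p} (i : ℕ) (ω : Ω) (r : ℝ) :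
    X.R i ω < r ↔ (X.N ω < i ∧ 0 < r) ∨ (i ≤ X.N ω ∧
      ∃ q : ℚ, (q : ℝ) < r ∧ 0 ≤ q ∧ i ≤ {j | j < X.N ω ∧ ‖X.D j ω‖ ≤ q}.ncard) := by
  have hfin : ∀ t : ℝ, {j | j < X.N ω ∧ ‖X.D j ω‖ ≤ t}.Finite := fun t =>
    (finite_Iio (X.N ω)).subset fun j hj => hj.1
  have hbdd : BddBelow {r : ℝ | 0 ≤ r ∧ i ≤ {j | j < X.N ω ∧ ‖X.D j ω‖ ≤ r}.ncard} :=
    ⟨0, fun r hr => hr.1⟩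
  have hcard : ∀ t : ℝ, {j | j < X.N ω ∧ ‖X.D j ω‖ ≤ t}.ncard ≤ X.N ω := by
    intro t
    refine (ncard_le_ncard (t := Iio (X.N ω)) (fun j hj => hj.1) (finite_Iio _)).trans ?_
    rw [← Nat.card_coe_set_eq]
    simp
  rcases lt_or_ge (X.N ω) i with h | h
  · have : {r : ℝ | 0 ≤ r ∧ i ≤ {j | j < X.N ω ∧ ‖X.D j ω‖ ≤ r}.ncard} = ∅ := by
      ext t
      simp only [mem_ofPred_eq, mem_empty_iff_false, iff_false, not_and, not_le]
      exact fun _ => (hcard t).trans_lt h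
    unfold R
    rw [this]
    simp [h, h.not_ge]
  · have hne : {r : ℝ | 0 ≤ r ∧ i ≤ {j | j < X.N ω ∧ ‖X.D j ω‖ ≤ r}.ncard}.Nonempty := by
      refine ⟨∑ j ∈ Finset.range (X.N ω), ‖X.D j ω‖,
        Finset.sum_nonneg fun j _ => norm_nonneg _, ?_⟩
      have : {j | j < X.N ω ∧ ‖X.D j ω‖ ≤ ∑ j ∈ Finset.range (X.N ω), ‖X.D j ω‖} =
          (Finset.range (X.N ω) : Set ℕ) := by
        ext j
        simp only [mem_ofPred_eq, Finset.coe_range, mem_Iio, and_iff_left_iff_imp]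
        exact fun hj => Finset.single_le_sum (f := fun j => ‖X.D j ω‖)
          (fun j _ => norm_nonneg _) (Finset.mem_range.2 hj)
      rw [this, ncard_coe_finset, Finset.card_range]
      exact h
    unfold R
    rw [csInf_lt_iff hbdd hne]
    simp only [h, h.not_gt, false_and, true_and, false_or]
    constructor
    · rintro ⟨t, ⟨ht0, ht⟩, htr⟩
      obtain ⟨q, hq1, hq2⟩ := exists_rat_btwn htr
      refine ⟨q, hq2, by exact_mod_cast ht0.trans hq1.le, ht.trans ?_⟩
      exact ncard_le_ncard (fun j hj => ⟨hj.1, hj.2.trans hq1.le⟩) (hfin _)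
    · rintro ⟨q, hqr, hq0, hq⟩
      exact ⟨q, ⟨by exact_mod_cast hq0, hq⟩, hqr⟩

section Measurability

variable {Ω : Type*} [MeasurableSpace Ω] {p : Params} {X : Network Ω p}

theorem measurable_R (hN : Measurable X.N) (hD : ∀ j, Measurable (X.D j)) (i : ℕ) :
    Measurable (X.R i) := by
  classical
  refine measurable_of_Iio fun r => ?_
  have hcount : ∀ q : ℝ, MeasurableSet {ω | i ≤ {j | j < X.N ω ∧ ‖X.D j ω‖ ≤ q}.ncard} := by
    intro q
    have hsum : ∀ n, Measurable fun ω => ∑ j ∈ Finset.range n,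
        if j < X.N ω ∧ ‖X.D j ω‖ ≤ q then 1 else 0 := fun n => by
      refine Finset.measurable_fun_sum _ fun j _ => Measurable.ite ?_ measurable_const
        measurable_const
      exact (measurableSet_lt measurable_const hN).inter
        (measurableSet_le (hD j).norm measurable_const)
    -- The number of summands is random. Treating it as a separate countable variable and then
    -- composing with `N` gives measurability.
    have hf := (measurable_from_prod_countable_right (f := fun x : ℕ × Ω =>
      ∑ j ∈ Finset.range x.1, if j < X.N x.2 ∧ ‖X.D j x.2‖ ≤ q then 1 else 0) hsum).comp
        (hN.prodMk measurable_id)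
    have hset : {ω | i ≤ {j | j < X.N ω ∧ ‖X.D j ω‖ ≤ q}.ncard} =
        {ω | i ≤ ∑ j ∈ Finset.range (X.N ω), if j < X.N ω ∧ ‖X.D j ω‖ ≤ q then 1 else 0} := by
      ext ω
      have : {j | j < X.N ω ∧ ‖X.D j ω‖ ≤ q} =
          ((Finset.range (X.N ω)).filter fun j => j < X.N ω ∧ ‖X.D j ω‖ ≤ q : Set ℕ) := by
        ext j
        simp +contextual
      rw [mem_ofPred_eq, this, ncard_coe_finset, Finset.card_filter]
      rfl
    rw [hset]
    exact measurableSet_le measurable_const hf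
  have : X.R i ⁻¹' Iio r = ({ω | X.N ω < i} ∩ {_ω | 0 < r}) ∪ ({ω | i ≤ X.N ω} ∩
      ⋃ q : ℚ, {_ω | (q : ℝ) < r ∧ 0 ≤ q} ∩
        {ω | i ≤ {j | j < X.N ω ∧ ‖X.D j ω‖ ≤ q}.ncard}) := by
    ext ω
    rw [mem_preimage, mem_Iio, R_lt_iff]
    simp [and_assoc]
  rw [this]
  refine ((measurableSet_lt hN measurable_const).inter (MeasurableSet.const _)).union
    ((measurableSet_le measurable_const hN).inter (MeasurableSet.iUnion fun q =>
      (MeasurableSet.const _).inter (hcount q)))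

theorem measurable_interference (hQ : Measurable X.Q) (hZ : ∀ j, Measurable (X.Z j))
    (hg : ∀ j, Measurable (X.g j)) : Measurable X.interference := by
  have : X.interference = fun ω => interf p.α (X.Q ω) (fun j => X.Z j ω) (fun j => X.g j ω) :=
    funext fun ω => X.interference_eq ω
  rw [this]
  exact (measurable_interf p.α).comp
    (hQ.prodMk ((measurable_pi_iff.2 hZ).prodMk (measurable_pi_iff.2 hg)))

theorem measurableSet_linkCovered (hN : Measurable X.N) (hD : ∀ j, Measurable (X.D j))
    {i : ℕ} (hh : Measurable (X.h i)) (hI : Measurable X.interference) :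
    MeasurableSet (X.linkCovered i) := by
  have hR := measurable_R hN hD i
  refine measurableSet_le measurable_const (Measurable.div ?_ (hI.const_add _))
  exact Measurable.ennreal_ofReal (hh.mul (hR.pow_const _))

end Measurability

/-! ### Grouping the independent ingredients -/

section Independence

variable {Ω : Type*} {p : Params} (X : Network Ω p)

/-- The σ-algebras of the independent ingredients of the model. -/
abbrev sig : Fin 7 → MeasurableSpace Ω :=
  ![MeasurableSpace.comap X.N inferInstance ⊔ ⨆ j, MeasurableSpace.comap (X.D j) inferInstance,
    ⨆ im : ℕ × Fin p.Cd, MeasurableSpace.comap (X.slot im.1 im.2) inferInstance,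
    ⨆ n, MeasurableSpace.comap (X.U n) inferInstance,
    ⨆ i, MeasurableSpace.comap (X.h i) inferInstance,
    MeasurableSpace.comap X.Q inferInstance,
    ⨆ j, MeasurableSpace.comap (X.Z j) inferInstance,
    ⨆ j, MeasurableSpace.comap (X.g j) inferInstance]

/-- The σ-algebra generated by a set of ingredients of the model. -/
abbrev sigGroup (S : Set (Fin 7)) : MeasurableSpace Ω := ⨆ a ∈ S, X.sig a

theorem sig_le_sigGroup {S : Set (Fin 7)} {a : Fin 7} (h : a ∈ S) : X.sig a ≤ X.sigGroup S :=
  le_iSup₂_of_le a h le_rfl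

theorem measurable_N_sigGroup {S : Set (Fin 7)} (h : 0 ∈ S) : Measurable[X.sigGroup S] X.N :=
  measurable_iff_comap_le.2 (le_trans le_sup_left (X.sig_le_sigGroup h))

theorem measurable_D_sigGroup {S : Set (Fin 7)} (h : 0 ∈ S) (j : ℕ) :
    Measurable[X.sigGroup S] (X.D j) :=
  measurable_iff_comap_le.2 ((le_iSup (fun j => MeasurableSpace.comap (X.D j) inferInstance) j).trans
    (le_trans le_sup_right (X.sig_le_sigGroup h)))

theorem measurable_slot_sigGroup {S : Set (Fin 7)} (h : 1 ∈ S) (i : ℕ) (m : Fin p.Cd) :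
    Measurable[X.sigGroup S] (X.slot i m) :=
  measurable_iff_comap_le.2 ((le_iSup (fun im : ℕ × Fin p.Cd =>
    MeasurableSpace.comap (X.slot im.1 im.2) inferInstance) (i, m)).trans (X.sig_le_sigGroup h))

theorem measurable_U_sigGroup {S : Set (Fin 7)} (h : 2 ∈ S) (n : ℕ) :
    Measurable[X.sigGroup S] (X.U n) :=
  measurable_iff_comap_le.2 ((le_iSup (fun n =>
    MeasurableSpace.comap (X.U n) inferInstance) n).trans (X.sig_le_sigGroup h))

theorem measurable_h_sigGroup {S : Set (Fin 7)} (h : 3 ∈ S) (i : ℕ) :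
    Measurable[X.sigGroup S] (X.h i) :=
  measurable_iff_comap_le.2 ((le_iSup (fun i =>
    MeasurableSpace.comap (X.h i) inferInstance) i).trans (X.sig_le_sigGroup h))

theorem measurable_Q_sigGroup {S : Set (Fin 7)} (h : 4 ∈ S) : Measurable[X.sigGroup S] X.Q :=
  measurable_iff_comap_le.2 (X.sig_le_sigGroup h)

theorem measurable_Z_sigGroup {S : Set (Fin 7)} (h : 5 ∈ S) (j : ℕ) :
    Measurable[X.sigGroup S] (X.Z j) :=
  measurable_iff_comap_le.2 ((le_iSup (fun j =>
    MeasurableSpace.comap (X.Z j) inferInstance) j).trans (X.sig_le_sigGroup h))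

theorem measurable_g_sigGroup {S : Set (Fin 7)} (h : 6 ∈ S) (j : ℕ) :
    Measurable[X.sigGroup S] (X.g j) :=
  measurable_iff_comap_le.2 ((le_iSup (fun j =>
    MeasurableSpace.comap (X.g j) inferInstance) j).trans (X.sig_le_sigGroup h))

/-- `measurable_R` holds for every σ-algebra making the positions and their number measurable, so it
applies to the σ-algebra of the geometry alone. -/
theorem measurable_R_sigGroup {S : Set (Fin 7)} (h : 0 ∈ S) (i : ℕ) :
    Measurable[X.sigGroup S] (X.R i) :=
  @measurable_R Ω (X.sigGroup S) p X (X.measurable_N_sigGroup h)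
    (fun j => X.measurable_D_sigGroup h j) i

theorem measurable_interference_sigGroup {S : Set (Fin 7)} (h4 : 4 ∈ S) (h5 : 5 ∈ S)
    (h6 : 6 ∈ S) : Measurable[X.sigGroup S] X.interference :=
  @measurable_interference Ω (X.sigGroup S) p X (X.measurable_Q_sigGroup h4)
    (X.measurable_Z_sigGroup h5) (X.measurable_g_sigGroup h6)

/-- The indices left out are `1` and `2`, the cached contents and the uniform draws. This is the
separation between coverage and serving. -/
theorem measurableSet_linkCovered_sigGroup (i : ℕ) :
    MeasurableSet[X.sigGroup {0, 3, 4, 5, 6}] (X.linkCovered i) :=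
  @measurableSet_linkCovered Ω (X.sigGroup {0, 3, 4, 5, 6}) p X
    (X.measurable_N_sigGroup (by simp)) (X.measurable_D_sigGroup (by simp)) i
    (X.measurable_h_sigGroup (by simp) i)
    (X.measurable_interference_sigGroup (by simp) (by simp) (by simp))

end Independence

namespace IsModel

variable {Ω : Type*} [MeasurableSpace Ω] {P : Measure Ω} {p : Params} {X : Network Ω p}

theorem sig_le (hX : X.IsModel P) (a : Fin 7) : X.sig a ≤ ‹MeasurableSpace Ω› := by
  fin_cases a
  · exact sup_le hX.measurable_N.comap_le (iSup_le fun j => (hX.measurable_D j).comap_le)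
  · exact iSup_le fun im => (hX.measurable_slot im.1 im.2).comap_le
  · exact iSup_le fun n => (hX.measurable_U n).comap_le
  · exact iSup_le fun i => (hX.measurable_h i).comap_le
  · exact hX.measurable_Q.comap_le
  · exact iSup_le fun j => (hX.law_Z.measurable j).comap_le
  · exact iSup_le fun j => (hX.measurable_g j).comap_le

theorem sigGroup_le (hX : X.IsModel P) (S : Set (Fin 7)) : X.sigGroup S ≤ ‹MeasurableSpace Ω› :=
  iSup₂_le fun a _ => hX.sig_le a

theorem indep_sigGroup (hX : X.IsModel P) {S T : Set (Fin 7)} (h : Disjoint S T) :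
    Indep (X.sigGroup S) (X.sigGroup T) P :=
  indep_iSup_of_disjoint hX.sig_le hX.indep h

theorem indepFun_of_sigGroup (hX : X.IsModel P) {S T : Set (Fin 7)} (h : Disjoint S T)
    {β γ : Type*} [MeasurableSpace β] [MeasurableSpace γ] {F : Ω → β} {G : Ω → γ}
    (hF : Measurable[X.sigGroup S] F) (hG : Measurable[X.sigGroup T] G) : IndepFun F G P :=
  (IndepFun_iff_Indep F G P).2
    (indep_of_indep_of_le (hX.indep_sigGroup h) hF.comap_le hG.comap_le)

theorem measurable_R (hX : X.IsModel P) (i : ℕ) : Measurable (X.R i) :=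
  Network.measurable_R hX.measurable_N hX.measurable_D i

theorem measurable_interference (hX : X.IsModel P) : Measurable X.interference :=
  Network.measurable_interference hX.measurable_Q hX.law_Z.measurable hX.measurable_g

theorem measurableSet_linkCovered (hX : X.IsModel P) (i : ℕ) : MeasurableSet (X.linkCovered i) :=
  Network.measurableSet_linkCovered hX.measurable_N hX.measurable_D (hX.measurable_h i)
    hX.measurable_interference

end IsModel

end Network

/-! ### Coverage of a link of given length -/

theorem expMeasure_one_sinr_event {τ a s : ℝ} (hτ : 0 < τ) (ha : 0 < a) (hs : s * a = τ)
    (x : ℝ≥0∞) :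
    expMeasure 1 {y | ENNReal.ofReal τ ≤ ENNReal.ofReal (y * a) / x} =
      expNeg (ENNReal.ofReal s * x) := by
  have hs0 : 0 < s := pos_of_mul_pos_left (hs ▸ hτ) ha.le
  -- For finite nonzero `x` the event is `y ≥ s x`, an exponential tail. The two extreme values are
  -- treated apart because of the conventions for division in `ℝ≥0∞`.
  rcases eq_or_ne x ⊤ with rfl | hx
  · simp [ENNReal.mul_top, hs0, hτ.not_ge]
  rcases eq_or_ne x 0 with rfl | hx0
  -- A positive number over `0` is `⊤`, but `0 / 0 = 0`. The event is thus positivity of the fading,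
  -- which has probability one.
  · have : {y | ENNReal.ofReal τ ≤ ENNReal.ofReal (y * a) / 0} = Ioi 0 := by
      ext y
      by_cases hy : 0 < y
      · simp [hy, ha, ENNReal.div_zero]
      · have : y * a ≤ 0 := mul_nonpos_of_nonpos_of_nonneg (not_lt.1 hy) ha.le
        simp [hy, ENNReal.ofReal_of_nonpos this, hτ]
    rw [this, expMeasure_one_Ioi_zero]
    simp
  · have hc : 0 < x.toReal := ENNReal.toReal_pos hx0 hx
    rw [← ENNReal.ofReal_toReal hx, ← ENNReal.ofReal_mul hs0.le,
      ← expMeasure_one_Ici (mul_pos hs0 hc).le]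
    congr 1
    ext y
    rw [mem_ofPred_eq, mem_Ici, ENNReal.le_div_iff_mul_le (by simp [hc]) (by simp),
      ← ENNReal.ofReal_mul hτ.le, ENNReal.ofReal_le_ofReal_iff', ← hs]
    have : 0 < s * a * x.toReal := by positivity
    rw [show s * a * x.toReal = (s * x.toReal) * a by ring] at this ⊢
    rw [mul_le_mul_iff_left₀ ha, or_iff_left (not_le.2 this)]

namespace Params

variable (p : Params)

/-- `2 π s λ̃ ∫_q^∞ v / (s + v ^ α) dv`, the exponent of the Laplace transform of the interference
with guard radius `q`. -/
def laplaceExponent (s q : ℝ) : ℝ :=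
  2 * Real.pi * (s * p.lamT * ∫ v in Ioi q, v / (s + v ^ p.α))

theorem measurable_laplaceExponent :
    Measurable fun x : ℝ × ℝ => p.laplaceExponent x.1 x.2 := by
  have h : Measurable fun x : (ℝ × ℝ) × ℝ => if x.1.2 < x.2 then x.2 / (x.1.1 + x.2 ^ p.α) else 0 :=
    Measurable.ite (measurableSet_lt (by fun_prop) (by fun_prop)) (by fun_prop) measurable_const
  have h2 := (h.stronglyMeasurable.integral_prod_right' (ν := volume)).measurable
  have : ∀ s q : ℝ, ∫ v in Ioi q, v / (s + v ^ p.α) =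
      ∫ v, if q < v then v / (s + v ^ p.α) else 0 := by
    intro s q
    rw [← integral_indicator measurableSet_Ioi]
    rfl
  unfold laplaceExponent
  simp_rw [this]
  exact ((measurable_fst.mul_const _).mul h2).const_mul _

theorem laplaceExponent_nonneg {s q : ℝ} (hs : 0 < s) (hq : 0 ≤ q) :
    0 ≤ p.laplaceExponent s q := by
  have h : 0 ≤ ∫ v in Ioi q, v / (s + v ^ p.α) := setIntegral_nonneg measurableSet_Ioi fun v hv => by
    have hv0 : 0 < v := lt_of_le_of_lt hq hv
    positivity
  have := p.lamT_nonneg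
  have := Real.pi_pos
  unfold laplaceExponent
  positivity

theorem laplaceExponent_le {s q : ℝ} (hs : 0 < s) (hq : 0 ≤ q) :
    p.laplaceExponent s q ≤ 2 * (Real.pi * p.lamT * (s ^ (2 / p.α) *
      ∫ v in Ioi (0 : ℝ), v / (1 + v ^ p.α))) := by
  have hα : 0 < p.α := by linarith [p.two_lt_α]
  have h : ∫ v in Ioi q, v / (s + v ^ p.α) ≤ ∫ v in Ioi (0 : ℝ), v / (s + v ^ p.α) := by
    refine setIntegral_mono_set (integrableOn_id_div_add_rpow p.two_lt_α hs) ?_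
      (Ioi_subset_Ioi hq).eventuallyLE
    refine (ae_restrict_iff' measurableSet_Ioi).2 (ae_of_all _ fun v hv => ?_)
    have hv0 : (0 : ℝ) < v := hv
    show (0 : ℝ) ≤ v / (s + v ^ p.α)
    positivity
  rw [← mul_integral_id_div_add_rpow hα hs]
  have := p.lamT_nonneg
  have := Real.pi_pos
  unfold laplaceExponent
  calc 2 * Real.pi * (s * p.lamT * ∫ v in Ioi q, v / (s + v ^ p.α))
      ≤ 2 * Real.pi * (s * p.lamT * ∫ v in Ioi (0 : ℝ), v / (s + v ^ p.α)) := by gcongr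
    _ = _ := by ring

end Params

namespace Network

variable {Ω : Type*} [MeasurableSpace Ω] (P : Measure Ω) {p : Params} (X : Network Ω p)

/-- The probability that the link with fading `h i` is in coverage if its length is `r`. -/
def covGiven (i : ℕ) (r : ℝ) : ℝ≥0∞ :=
  P {ω | ENNReal.ofReal p.τ ≤ ENNReal.ofReal (X.h i ω * r ^ (-p.α)) /
    (ENNReal.ofReal (p.noise / p.Pd) + X.interference ω)}

namespace IsModel

variable {P X}

theorem measurableSet_covGiven :
    MeasurableSet {x : ℝ × ℝ × ℝ≥0∞ | ENNReal.ofReal p.τ ≤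
      ENNReal.ofReal (x.2.1 * x.1 ^ (-p.α)) / (ENNReal.ofReal (p.noise / p.Pd) + x.2.2)} := by
  refine measurableSet_le measurable_const (Measurable.div ?_ (by fun_prop))
  exact Measurable.ennreal_ofReal (by fun_prop)

theorem measurable_covGiven [IsProbabilityMeasure P] (hX : X.IsModel P) (i : ℕ) :
    Measurable (X.covGiven P i) :=
  measurable_measure_prodMk_left (ν := P) (s := {x : ℝ × Ω | ENNReal.ofReal p.τ ≤
      ENNReal.ofReal (X.h i x.2 * x.1 ^ (-p.α)) /
        (ENNReal.ofReal (p.noise / p.Pd) + X.interference x.2)})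
    (measurableSet_covGiven.preimage (measurable_fst.prodMk
      (((hX.measurable_h i).comp measurable_snd).prodMk
        (hX.measurable_interference.comp measurable_snd))))

/-- The pair `(N, R i)` is independent of the fading and the interference, so the link length can be
frozen. -/
theorem measure_inter_linkCovered [IsProbabilityMeasure P] (hX : X.IsModel P) (i : ℕ)
    (B : Set ℕ) :
    P ({ω | X.N ω ∈ B} ∩ X.linkCovered i) =
      ∫⁻ ω in {ω | X.N ω ∈ B}, X.covGiven P i (X.R i ω) ∂P := by
  classical
  have hB : MeasurableSet {ω | X.N ω ∈ B} := hX.measurable_N (MeasurableSet.of_discrete (s := B))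
  have hind : IndepFun (fun ω => (X.N ω, X.R i ω)) (fun ω => (X.h i ω, X.interference ω)) P := by
    refine hX.indepFun_of_sigGroup (S := {0}) (T := {3, 4, 5, 6}) (by simp) ?_ ?_
    · exact Measurable.prodMk
        (X.measurable_N_sigGroup (S := {0}) (by simp)) (X.measurable_R_sigGroup (S := {0}) (by simp) i)
    · exact Measurable.prodMk
        (X.measurable_h_sigGroup (S := {3, 4, 5, 6}) (by simp) i)
        (X.measurable_interference_sigGroup (S := {3, 4, 5, 6}) (by simp) (by simp)
          (by simp))
  set C : Set ((ℕ × ℝ) × ℝ × ℝ≥0∞) := {x | x.1.1 ∈ B ∧ ENNReal.ofReal p.τ ≤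
      ENNReal.ofReal (x.2.1 * x.1.2 ^ (-p.α)) / (ENNReal.ofReal (p.noise / p.Pd) + x.2.2)} with hC
  have hCm : MeasurableSet C :=
    (MeasurableSet.of_discrete (s := B)).preimage (measurable_fst.comp measurable_fst) |>.inter
      (measurableSet_covGiven.preimage (f := fun x : (ℕ × ℝ) × ℝ × ℝ≥0∞ => (x.1.2, x.2))
        (by fun_prop))
  have h := IndepFun.lintegral_prodMk hind (hX.measurable_N.prodMk (hX.measurable_R i))
    ((hX.measurable_h i).prodMk hX.measurable_interference)
    (φ := C.indicator 1) (measurable_one.indicator hCm)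
  have hl : ∀ ω, C.indicator (1 : (ℕ × ℝ) × ℝ × ℝ≥0∞ → ℝ≥0∞) ((X.N ω, X.R i ω), X.h i ω, X.interference ω) =
      ({ω | X.N ω ∈ B} ∩ X.linkCovered i).indicator 1 ω := by
    intro ω
    rfl
  simp_rw [hl] at h
  rw [lintegral_indicator_one (hB.inter (hX.measurableSet_linkCovered i))] at h
  rw [h, ← lintegral_indicator hB]
  refine lintegral_congr fun ω => ?_
  by_cases hω : X.N ω ∈ B
  · rw [indicator_of_mem (show ω ∈ {ω | X.N ω ∈ B} from hω), covGiven,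
      ← lintegral_indicator_one]
    · refine lintegral_congr fun ω' => ?_
      simp only [indicator, hC, mem_ofPred_eq, hω, true_and]
      split_ifs <;> rfl
    · exact measurableSet_covGiven.preimage (f := fun ω' => (X.R i ω, X.h i ω', X.interference ω'))
        (measurable_const.prodMk ((hX.measurable_h i).prodMk hX.measurable_interference))
  · rw [indicator_of_notMem (show ω ∉ {ω | X.N ω ∈ B} from hω)]
    simp [hC, hω]

/-- A general set `B` covers both uses: `Ici i` for the link coverage and singletons for the slices
of the US scheme. -/
theorem cond_linkCovered [IsProbabilityMeasure P] (hX : X.IsModel P) (i : ℕ) (B : Set ℕ) :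
    (cond P {ω | X.N ω ∈ B}) (X.linkCovered i) =
      ∫⁻ r, X.covGiven P i r ∂(cond P {ω | X.N ω ∈ B}).map (X.R i) := by
  have hB : MeasurableSet {ω | X.N ω ∈ B} := hX.measurable_N (MeasurableSet.of_discrete (s := B))
  rw [lintegral_map (hX.measurable_covGiven i) (hX.measurable_R i), cond_apply hB,
    hX.measure_inter_linkCovered, ProbabilityTheory.cond, lintegral_smul_measure, smul_eq_mul]

/-- With the interference frozen, the fading tail gives `expNeg` of noise plus interference, and the
noise factors out. -/
theorem covGiven_eq_lintegral [IsProbabilityMeasure P] (hX : X.IsModel P) (i : ℕ) {r : ℝ}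
    (hr : 0 < r) :
    X.covGiven P i r = ENNReal.ofReal (Real.exp (-(p.sd r * (p.noise / p.Pd)))) *
      ∫⁻ ω, expNeg (ENNReal.ofReal (p.sd r) * X.interference ω) ∂P := by
  have hind : IndepFun X.interference (X.h i) P :=
    hX.indepFun_of_sigGroup (S := {4, 5, 6}) (T := {3}) (by simp)
      (X.measurable_interference_sigGroup (by simp) (by simp) (by simp))
      (X.measurable_h_sigGroup (by simp) i)
  set C : Set (ℝ≥0∞ × ℝ) := {x | ENNReal.ofReal p.τ ≤
      ENNReal.ofReal (x.2 * r ^ (-p.α)) / (ENNReal.ofReal (p.noise / p.Pd) + x.1)} with hC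
  have hCm : MeasurableSet C :=
    measurableSet_covGiven.preimage (f := fun x : ℝ≥0∞ × ℝ => (r, x.2, x.1)) (by fun_prop)
  have h := IndepFun.lintegral_prodMk hind hX.measurable_interference (hX.measurable_h i)
    (φ := C.indicator 1) (measurable_one.indicator hCm)
  have hrα : 0 < r ^ (-p.α) := Real.rpow_pos_of_pos hr _
  have hs : p.sd r * r ^ (-p.α) = p.τ := by
    rw [Params.sd, mul_assoc, ← Real.rpow_add hr, add_neg_cancel, Real.rpow_zero, mul_one]
  have hs0 := p.sd_pos hr
  have hn : 0 ≤ p.noise / p.Pd := div_nonneg p.noise_nonneg p.Pd_pos.le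
  have hin : ∀ x : ℝ≥0∞, ∫⁻ ω', C.indicator (1 : ℝ≥0∞ × ℝ → ℝ≥0∞) (x, X.h i ω') ∂P =
      ENNReal.ofReal (Real.exp (-(p.sd r * (p.noise / p.Pd)))) *
        expNeg (ENNReal.ofReal (p.sd r) * x) := by
    intro x
    rw [← lintegral_map (f := fun y => C.indicator (1 : ℝ≥0∞ × ℝ → ℝ≥0∞) (x, y))
      ((measurable_one.indicator hCm).comp measurable_prodMk_left) (hX.measurable_h i), hX.law_h i]
    have := expMeasure_one_sinr_event p.τ_pos hrα hs (ENNReal.ofReal (p.noise / p.Pd) + x)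
    rw [mul_add, expNeg_add, ← ENNReal.ofReal_mul hs0.le, expNeg_ofReal (mul_nonneg hs0.le hn)]
      at this
    rw [← this]
    exact lintegral_indicator_one (hCm.preimage measurable_prodMk_left)
  have hpre : MeasurableSet {ω | ENNReal.ofReal p.τ ≤ ENNReal.ofReal (X.h i ω * r ^ (-p.α)) /
    (ENNReal.ofReal (p.noise / p.Pd) + X.interference ω)} :=
    hCm.preimage (hX.measurable_interference.prodMk (hX.measurable_h i))
  simp_rw [hin] at h
  have hm : Measurable fun ω => expNeg (ENNReal.ofReal (p.sd r) * X.interference ω) :=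
    measurable_expNeg.comp (hX.measurable_interference.const_mul _)
  rw [lintegral_const_mul _ hm] at h
  rw [← h, covGiven, ← lintegral_indicator_one hpre]
  rfl

theorem ae_map_Q_pos (hX : X.IsModel P) : ∀ᵐ q ∂P.map X.Q, 0 < q := by
  rw [hX.law_Q]
  exact (withDensity_absolutelyContinuous _ _).ae_le (ae_restrict_mem measurableSet_Ioi)

theorem lintegral_expNeg_interference [IsProbabilityMeasure P] (hX : X.IsModel P) {s : ℝ}
    (hs : 0 < s) :
    ∫⁻ ω, expNeg (ENNReal.ofReal s * X.interference ω) ∂P =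
      ∫⁻ q, ENNReal.ofReal (Real.exp (-p.laplaceExponent s q)) ∂P.map X.Q := by
  have hind : IndepFun X.Q (fun ω => ((fun j => X.Z j ω), fun j => X.g j ω)) P := by
    refine hX.indepFun_of_sigGroup (S := {4}) (T := {5, 6}) (by simp)
      (X.measurable_Q_sigGroup (by simp)) ?_
    have hZ := @measurable_pi_lambda _ _ _ (X.sigGroup {5, 6}) _ (fun ω j => X.Z j ω)
      (X.measurable_Z_sigGroup (by simp))
    have hg := @measurable_pi_lambda _ _ _ (X.sigGroup {5, 6}) _ (fun ω j => X.g j ω)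
      (X.measurable_g_sigGroup (by simp))
    exact Measurable.prodMk hZ hg
  have hZg : IndepFun (fun ω j => X.Z j ω) (fun ω j => X.g j ω) P :=
    hX.indepFun_of_sigGroup (S := {5}) (T := {6}) (by simp)
      (@measurable_pi_lambda _ _ _ (X.sigGroup {5}) _ _ (X.measurable_Z_sigGroup (by simp)))
      (@measurable_pi_lambda _ _ _ (X.sigGroup {6}) _ _ (X.measurable_g_sigGroup (by simp)))
  have hφ : Measurable fun x : ℝ × (ℕ → Plane) × (ℕ → ℝ) =>
      expNeg (ENNReal.ofReal s * interf p.α x.1 x.2.1 x.2.2) :=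
    measurable_expNeg.comp ((measurable_interf p.α).const_mul _)
  have hZgm : Measurable fun ω => ((fun j => X.Z j ω), fun j => X.g j ω) :=
    (measurable_pi_iff.2 hX.law_Z.measurable).prodMk (measurable_pi_iff.2 hX.measurable_g)
  simp_rw [X.interference_eq]
  rw [IndepFun.lintegral_prodMk hind hX.measurable_Q hZgm hφ]
  have hm : Measurable fun q => ∫⁻ ω', expNeg (ENNReal.ofReal s *
      interf p.α q (fun j => X.Z j ω') fun j => X.g j ω') ∂P :=
    Measurable.lintegral_prod_right' (f := fun x : ℝ × Ω => expNeg (ENNReal.ofReal s *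
      interf p.α x.1 (fun j => X.Z j x.2) fun j => X.g j x.2))
      (hφ.comp (measurable_fst.prodMk (hZgm.comp measurable_snd)))
  rw [← lintegral_map (f := fun q => ∫⁻ ω', expNeg (ENNReal.ofReal s *
      interf p.α q (fun j => X.Z j ω') fun j => X.g j ω') ∂P) hm hX.measurable_Q]
  refine lintegral_congr_ae ?_
  filter_upwards [hX.ae_map_Q_pos] with q hq
  rw [lintegral_expNeg_interf p.lamT_nonneg p.two_lt_α hs hq hX.law_Z hX.measurable_g
    hX.law_g hX.indep_g hZg]
  rfl

end IsModel

end Network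

/-! ### Jensen's inequality and its gap -/

theorem exp_neg_le_quadratic {y : ℝ} (hy : 0 ≤ y) : Real.exp (-y) ≤ 1 - y + y ^ 2 / 2 := by
  have h := Real.quadratic_le_exp_of_nonneg hy
  rw [Real.exp_neg, inv_le_iff_one_le_mul₀ (Real.exp_pos y)]
  have h0 : 0 ≤ 1 - y + y ^ 2 / 2 := by nlinarith [sq_nonneg (y - 1)]
  -- The product of `1 - y + y ^ 2 / 2` and `1 + y + y ^ 2 / 2` is `1 + y ^ 4 / 4`.
  refine le_trans ?_ (mul_le_mul_of_nonneg_left h h0)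
  nlinarith [sq_nonneg (y ^ 2)]

section JensenGap

variable {β : Type*} [MeasurableSpace β] {ν : Measure β} [IsProbabilityMeasure ν] {Y : β → ℝ}
  {M : ℝ}

theorem integrable_of_ae_mem_Icc (hm : AEStronglyMeasurable Y ν)
    (h : ∀ᵐ x ∂ν, Y x ∈ Icc 0 M) : Integrable Y ν :=
  Integrable.of_bound hm M (h.mono fun x hx => by rw [Real.norm_of_nonneg hx.1]; exact hx.2)

theorem integrable_exp_neg_of_ae_mem_Icc (hm : AEStronglyMeasurable Y ν)
    (h : ∀ᵐ x ∂ν, Y x ∈ Icc 0 M) : Integrable (fun x => Real.exp (-Y x)) ν :=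
  Integrable.of_bound (Real.continuous_exp.comp_aestronglyMeasurable hm.neg) 1
    (h.mono fun x hx => by
      rw [Real.norm_of_nonneg (Real.exp_pos _).le]
      simpa using hx.1)

/-- Integrate the tangent line inequality for the exponential at the mean of `Y`. -/
theorem exp_neg_integral_le (hm : AEStronglyMeasurable Y ν) (h : ∀ᵐ x ∂ν, Y x ∈ Icc 0 M) :
    Real.exp (-∫ x, Y x ∂ν) ≤ ∫ x, Real.exp (-Y x) ∂ν := by
  have hY := integrable_of_ae_mem_Icc hm h
  set m := ∫ x, Y x ∂ν with hm'
  have hi : Integrable (fun x => Real.exp (-m) * (1 + m - Y x)) ν :=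
    ((integrable_const _).sub hY).const_mul _
  calc Real.exp (-m) = ∫ x, Real.exp (-m) * (1 + m - Y x) ∂ν := by
        rw [integral_const_mul, integral_sub (integrable_const _) hY]
        simp [← hm']
    _ ≤ ∫ x, Real.exp (-Y x) ∂ν := by
        refine integral_mono hi (integrable_exp_neg_of_ae_mem_Icc hm h) fun x => ?_
        have : Real.exp (-Y x) = Real.exp (-m) * Real.exp (m - Y x) := by
          rw [← Real.exp_add]
          congr 1
          ring
        simp only [this]
        exact mul_le_mul_of_nonneg_left (by linarith [Real.add_one_le_exp (m - Y x)])
          (Real.exp_pos _).le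

/-- With mean `m`, the quadratic bound gives at most `1 - m + M ^ 2 / 2`, and `1 - m ≤ exp (-m)`.
The alternative `1` is the trivial bound. For `M = 2 π λ̃ K s^(2/α)`, the term `M ^ 2 / 2` is the
stated error. -/
theorem integral_exp_neg_le (hm : AEStronglyMeasurable Y ν) (h : ∀ᵐ x ∂ν, Y x ∈ Icc 0 M) :
    ∫ x, Real.exp (-Y x) ∂ν ≤ Real.exp (-∫ x, Y x ∂ν) + min 1 (M ^ 2 / 2) := by
  have hY := integrable_of_ae_mem_Icc hm h
  have hE := integrable_exp_neg_of_ae_mem_Icc hm h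
  rw [← min_add_add_left]
  refine le_min ?_ ?_
  · have : ∫ x, Real.exp (-Y x) ∂ν ≤ ∫ _x, (1 : ℝ) ∂ν :=
      integral_mono_ae hE (integrable_const _) (h.mono fun x hx => by simpa using hx.1)
    simp only [integral_const, probReal_univ, smul_eq_mul, mul_one] at this
    linarith [Real.exp_pos (-∫ x, Y x ∂ν)]
  · have hi : Integrable (fun x => 1 + M ^ 2 / 2 - Y x) ν := (integrable_const _).sub hY
    have : ∫ x, Real.exp (-Y x) ∂ν ≤ ∫ x, (1 + M ^ 2 / 2 - Y x) ∂ν := by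
      refine integral_mono_ae hE hi (h.mono fun x hx => ?_)
      have h1 := exp_neg_le_quadratic hx.1
      have h2 : Y x ^ 2 ≤ M ^ 2 := pow_le_pow_left₀ hx.1 hx.2 2
      show Real.exp (-Y x) ≤ 1 + M ^ 2 / 2 - Y x
      linarith
    rw [integral_sub (integrable_const _) hY] at this
    simp only [integral_const, probReal_univ, smul_eq_mul, one_mul] at this
    linarith [Real.add_one_le_exp (-∫ x, Y x ∂ν)]

end JensenGap

/-! ### The approximate coverage as the exponential of a mean -/

theorem integrable_withDensity_ofReal_Ioi {w : ℝ → ℝ} (hw : Measurable w)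
    (h0 : ∀ x, 0 < x → 0 ≤ w x) (g : ℝ → ℝ) :
    Integrable g ((volume.restrict (Ioi (0 : ℝ))).withDensity fun x => ENNReal.ofReal (w x)) ↔
      IntegrableOn (fun x => g x * w x) (Ioi 0) := by
  rw [integrable_withDensity_iff_integrable_smul' hw.ennreal_ofReal
    (ae_of_all _ fun _ => ENNReal.ofReal_lt_top)]
  refine integrableOn_congr_fun (fun x hx => ?_) measurableSet_Ioi
  simp only [ENNReal.toReal_ofReal (h0 x hx), smul_eq_mul, mul_comm]

theorem integral_withDensity_ofReal_Ioi {w : ℝ → ℝ} (hw : Measurable w)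
    (h0 : ∀ x, 0 < x → 0 ≤ w x) (g : ℝ → ℝ) :
    ∫ x, g x ∂(volume.restrict (Ioi (0 : ℝ))).withDensity (fun x => ENNReal.ofReal (w x)) =
      ∫ x in Ioi (0 : ℝ), g x * w x := by
  rw [integral_withDensity_eq_integral_toReal_smul hw.ennreal_ofReal
    (ae_of_all _ fun _ => ENNReal.ofReal_lt_top)]
  refine setIntegral_congr_fun measurableSet_Ioi fun x hx => ?_
  simp only [ENNReal.toReal_ofReal (h0 x hx), smul_eq_mul, mul_comm]

theorem Params.deltaKernel_eq_laplaceExponent (p : Params) {s q : ℝ} (hs : 0 < s) (hq : 0 < q) :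
    p.deltaKernel s q =
      (p.α - 2) / (2 * Real.pi * (s * p.lamT)) * p.laplaceExponent s q := by
  have h1 := p.lamT_pos.ne'
  have h2 := Real.pi_pos.ne'
  rw [p.deltaKernel_eq hs hq, Params.laplaceExponent]
  field_simp

theorem Params.sd_rpow (p : Params) {r : ℝ} (hr : 0 < r) :
    p.sd r ^ (2 / p.α) = p.τ ^ (2 / p.α) * r ^ 2 := by
  have hα : p.α ≠ 0 := by linarith [p.two_lt_α]
  rw [Params.sd, Real.mul_rpow p.τ_pos.le (Real.rpow_nonneg hr.le _), ← Real.rpow_mul hr.le,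
    mul_div_cancel₀ _ hα, Real.rpow_two]

/-- The factor of the link distance density in the approximate link coverage. -/
def Params.covFactor (p : Params) (r : ℝ) : ℝ :=
  Real.exp (-(2 * Real.pi * (p.sd r * p.lamT * p.delta (p.sd r) / (p.α - 2)))) *
    Real.exp (-(p.sd r * (p.noise / p.Pd)))

/-- The factor of the link distance density in the error bound. -/
def Params.errFactor (p : Params) (r : ℝ) : ℝ :=
  min 1 (2 * (Real.pi * p.lamT * p.τ ^ (2 / p.α) *
      (∫ v in Ioi (0 : ℝ), v / (1 + v ^ p.α)) * r ^ 2) ^ 2) *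
    Real.exp (-(p.sd r * (p.noise / p.Pd)))

theorem Params.exp_neg_noise_le_one (p : Params) {r : ℝ} (hr : 0 < r) :
    Real.exp (-(p.sd r * (p.noise / p.Pd))) ≤ 1 := by
  have := mul_nonneg (p.sd_pos hr).le (div_nonneg p.noise_nonneg p.Pd_pos.le)
  simpa using this

theorem Params.measurable_sd (p : Params) : Measurable p.sd := by
  unfold Params.sd
  fun_prop

theorem Params.measurable_errFactor (p : Params) : Measurable p.errFactor := by
  have := p.measurable_sd
  unfold Params.errFactor
  fun_prop

theorem Params.errFactor_mem_Icc (p : Params) {r : ℝ} (hr : 0 < r) : p.errFactor r ∈ Icc 0 1 := by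
  have h : 0 ≤ min 1 (2 * (Real.pi * p.lamT * p.τ ^ (2 / p.α) *
      (∫ v in Ioi (0 : ℝ), v / (1 + v ^ p.α)) * r ^ 2) ^ 2) := le_min zero_le_one (by positivity)
  exact ⟨mul_nonneg h (Real.exp_pos _).le,
    mul_le_one₀ (min_le_left _ _) (Real.exp_pos _).le (p.exp_neg_noise_le_one hr)⟩

namespace Network.IsModel

variable {Ω : Type*} [MeasurableSpace Ω] {P : Measure Ω} {p : Params} {X : Network Ω p}

theorem ae_laplaceExponent_mem_Icc (hX : X.IsModel P) {s : ℝ} (hs : 0 < s) :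
    ∀ᵐ q ∂P.map X.Q, p.laplaceExponent s q ∈
      Icc 0 (2 * (Real.pi * p.lamT * (s ^ (2 / p.α) *
        ∫ v in Ioi (0 : ℝ), v / (1 + v ^ p.α)))) := by
  filter_upwards [hX.ae_map_Q_pos] with q hq
  exact ⟨p.laplaceExponent_nonneg hs hq.le, p.laplaceExponent_le hs hq.le⟩

theorem aestronglyMeasurable_laplaceExponent (s : ℝ) :
    AEStronglyMeasurable (p.laplaceExponent s) (P.map X.Q) :=
  (p.measurable_laplaceExponent.comp measurable_prodMk_left).aestronglyMeasurable

theorem integrableOn_deltaKernel_mul_fQ [IsProbabilityMeasure P] (hX : X.IsModel P) {s : ℝ}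
    (hs : 0 < s) : IntegrableOn (fun q => p.deltaKernel s q * p.fQ q) (Ioi 0) := by
  have := Measure.isProbabilityMeasure_map (μ := P) hX.measurable_Q.aemeasurable
  rw [← integrable_withDensity_ofReal_Ioi p.measurable_fQ fun x hx => p.fQ_nonneg hx.le, ← hX.law_Q]
  refine ((integrable_of_ae_mem_Icc (aestronglyMeasurable_laplaceExponent s)
    (hX.ae_laplaceExponent_mem_Icc hs)).const_mul
      ((p.α - 2) / (2 * Real.pi * (s * p.lamT)))).congr ?_
  filter_upwards [hX.ae_map_Q_pos] with q hq
  exact (p.deltaKernel_eq_laplaceExponent hs hq).symm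

/-- This identifies the exponent in the approximation as the mean over `Q` of the exact one, so the
approximation error is a Jensen gap. -/
theorem integral_laplaceExponent (hX : X.IsModel P) {s : ℝ} (hs : 0 < s) :
    ∫ q, p.laplaceExponent s q ∂P.map X.Q =
      2 * Real.pi * (s * p.lamT * p.delta s / (p.α - 2)) := by
  have hα : p.α - 2 ≠ 0 := by linarith [p.two_lt_α]
  have h1 := p.lamT_pos.ne'
  have h2 := Real.pi_pos.ne'
  have h : p.delta s = (p.α - 2) / (2 * Real.pi * (s * p.lamT)) *
      ∫ q, p.laplaceExponent s q ∂P.map X.Q := by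
    rw [← integral_const_mul, hX.law_Q, integral_withDensity_ofReal_Ioi p.measurable_fQ
      fun x hx => p.fQ_nonneg hx.le]
    refine setIntegral_congr_fun measurableSet_Ioi fun q hq => ?_
    simp only [p.deltaKernel_eq_laplaceExponent hs hq]
  rw [h]
  field_simp

theorem covFactor_eq (hX : X.IsModel P) {r : ℝ} (hr : 0 < r) :
    p.covFactor r = Real.exp (-∫ q, p.laplaceExponent (p.sd r) q ∂P.map X.Q) *
      Real.exp (-(p.sd r * (p.noise / p.Pd))) := by
  rw [hX.integral_laplaceExponent (p.sd_pos hr), Params.covFactor]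

theorem toReal_covGiven [IsProbabilityMeasure P] (hX : X.IsModel P) (i : ℕ) {r : ℝ}
    (hr : 0 < r) :
    (X.covGiven P i r).toReal = (∫ q, Real.exp (-p.laplaceExponent (p.sd r) q) ∂P.map X.Q) *
      Real.exp (-(p.sd r * (p.noise / p.Pd))) := by
  have := Measure.isProbabilityMeasure_map (μ := P) hX.measurable_Q.aemeasurable
  have hi := integrable_exp_neg_of_ae_mem_Icc (aestronglyMeasurable_laplaceExponent (P := P)
    (X := X) (p.sd r)) (hX.ae_laplaceExponent_mem_Icc (p.sd_pos hr))
  rw [hX.covGiven_eq_lintegral i hr, hX.lintegral_expNeg_interference (p.sd_pos hr),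
    ← ofReal_integral_eq_lintegral_ofReal hi (ae_of_all _ fun q => (Real.exp_pos _).le),
    ENNReal.toReal_mul, ENNReal.toReal_ofReal (Real.exp_pos _).le,
    ENNReal.toReal_ofReal (integral_nonneg fun q => (Real.exp_pos _).le), mul_comm]

theorem covFactor_le_covGiven [IsProbabilityMeasure P] (hX : X.IsModel P) (i : ℕ) {r : ℝ}
    (hr : 0 < r) : p.covFactor r ≤ (X.covGiven P i r).toReal := by
  have := Measure.isProbabilityMeasure_map (μ := P) hX.measurable_Q.aemeasurable
  rw [hX.covFactor_eq hr, hX.toReal_covGiven i hr]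
  exact mul_le_mul_of_nonneg_right (exp_neg_integral_le (aestronglyMeasurable_laplaceExponent _)
    (hX.ae_laplaceExponent_mem_Icc (p.sd_pos hr))) (Real.exp_pos _).le

theorem covGiven_le_covFactor_add_errFactor [IsProbabilityMeasure P] (hX : X.IsModel P) (i : ℕ)
    {r : ℝ} (hr : 0 < r) : (X.covGiven P i r).toReal ≤ p.covFactor r + p.errFactor r := by
  have := Measure.isProbabilityMeasure_map (μ := P) hX.measurable_Q.aemeasurable
  have h := integral_exp_neg_le (aestronglyMeasurable_laplaceExponent (P := P) (X := X) (p.sd r))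
    (hX.ae_laplaceExponent_mem_Icc (p.sd_pos hr))
  rw [hX.covFactor_eq hr, hX.toReal_covGiven i hr, Params.errFactor, ← add_mul]
  refine mul_le_mul_of_nonneg_right (h.trans (le_of_eq ?_)) (Real.exp_pos _).le
  rw [p.sd_rpow hr]
  congr 2
  ring

/-- The representation through `laplaceExponent` is jointly measurable but agrees with `covFactor`
only for `r > 0`. That is enough, since the law of `R i` lives on the positive half-line. -/
theorem measurable_covFactor_congr [IsProbabilityMeasure P] (hX : X.IsModel P) :
    ∃ C : ℝ → ℝ, Measurable C ∧ ∀ r, 0 < r → p.covFactor r = C r := by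
  have := Measure.isProbabilityMeasure_map (μ := P) hX.measurable_Q.aemeasurable
  have h := (p.measurable_laplaceExponent.stronglyMeasurable.integral_prod_right'
    (ν := P.map X.Q)).measurable
  have hsd := p.measurable_sd
  refine ⟨_, ?_, fun r hr => hX.covFactor_eq hr⟩
  exact (Real.measurable_exp.comp (h.comp hsd).neg).mul (by fun_prop)

theorem linkCov_eq_integral [IsProbabilityMeasure P] (hX : X.IsModel P) (i : ℕ) :
    X.linkCov P i =
      ∫ r, (X.covGiven P i r).toReal ∂(cond P (X.atLeast i)).map (X.R i) := by
  rw [integral_toReal (hX.measurable_covGiven i).aemeasurable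
    (ae_of_all _ fun r => measure_lt_top _ _), Network.linkCov, measureReal_def]
  congr 1
  exact hX.cond_linkCovered i (Ici i)

/-- The approximation of the link coverage probability and its error. -/
theorem linkCov_bounds [IsProbabilityMeasure P] (hX : X.IsModel P) (i : ℕ) {f : ℝ → ℝ}
    (hf : Measurable f) (hf0 : ∀ r, 0 ≤ f r)
    (hlaw : (cond P (X.atLeast i)).map (X.R i) =
      (volume.restrict (Ioi (0 : ℝ))).withDensity fun r => ENNReal.ofReal (f r)) :
    IntegrableOn (p.covIntegrand f) (Ioi (0 : ℝ)) ∧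
      ∫ r in Ioi (0 : ℝ), p.covIntegrand f r ≤ X.linkCov P i ∧
      X.linkCov P i ≤ (∫ r in Ioi (0 : ℝ), p.covIntegrand f r) +
        ∫ r in Ioi (0 : ℝ), p.errIntegrand f r := by
  have hpos : ∀ᵐ r ∂(cond P (X.atLeast i)).map (X.R i), 0 < r := by
    rw [hlaw]
    exact (withDensity_absolutelyContinuous _ _).ae_le (ae_restrict_mem measurableSet_Ioi)
  obtain ⟨C, hCm, hC⟩ := hX.measurable_covFactor_congr
  have hle : ∀ r, (X.covGiven P i r).toReal ∈ Icc 0 1 := fun r =>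
    ⟨ENNReal.toReal_nonneg, measureReal_le_one⟩
  have hcov0 : ∀ r, 0 ≤ p.covFactor r := fun r => mul_nonneg (Real.exp_pos _).le (Real.exp_pos _).le
  have h1 : Integrable p.covFactor ((cond P (X.atLeast i)).map (X.R i)) := by
    refine Integrable.of_bound ⟨C, hCm.stronglyMeasurable, hpos.mono fun r hr => hC r hr⟩ 1
      (hpos.mono fun r hr => ?_)
    rw [Real.norm_of_nonneg (hcov0 r)]
    exact (hX.covFactor_le_covGiven i hr).trans (hle r).2
  have h2 : Integrable (fun r => (X.covGiven P i r).toReal)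
      ((cond P (X.atLeast i)).map (X.R i)) := by
    refine Integrable.of_bound (hX.measurable_covGiven i).ennreal_toReal.aestronglyMeasurable 1
      (ae_of_all _ fun r => ?_)
    rw [Real.norm_of_nonneg (hle r).1]
    exact (hle r).2
  have h3 : Integrable p.errFactor ((cond P (X.atLeast i)).map (X.R i)) := by
    refine Integrable.of_bound p.measurable_errFactor.aestronglyMeasurable 1
      (hpos.mono fun r hr => ?_)
    have := p.errFactor_mem_Icc hr
    rw [Real.norm_of_nonneg this.1]
    exact this.2
  have hi1 : ∫ r, p.covFactor r ∂(cond P (X.atLeast i)).map (X.R i) =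
      ∫ r in Ioi (0 : ℝ), p.covIntegrand f r := by
    rw [hlaw]
    exact integral_withDensity_ofReal_Ioi hf (fun r _ => hf0 r) _
  have hi3 : ∫ r, p.errFactor r ∂(cond P (X.atLeast i)).map (X.R i) =
      ∫ r in Ioi (0 : ℝ), p.errIntegrand f r := by
    rw [hlaw]
    exact integral_withDensity_ofReal_Ioi hf (fun r _ => hf0 r) _
  refine ⟨?_, ?_, ?_⟩
  · rw [hlaw] at h1
    exact (integrable_withDensity_ofReal_Ioi hf (fun r _ => hf0 r) _).1 h1
  · rw [hX.linkCov_eq_integral, ← hi1]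
    exact integral_mono_ae h1 h2 (hpos.mono fun r hr => hX.covFactor_le_covGiven i hr)
  · rw [hX.linkCov_eq_integral, ← hi1, ← hi3, ← integral_add h1 h3]
    exact integral_mono_ae h2 (h1.add h3)
      (hpos.mono fun r hr => hX.covGiven_le_covFactor_add_errFactor i hr)

end Network.IsModel

/-! ### Tails of the helper count and hit rates -/

theorem Gamma_add_natCast_eq {x : ℝ} (hx : 0 < x) (n : ℕ) :
    Real.Gamma (x + n) = Real.Gamma x * (ascPochhammer ℝ n).eval x := by
  induction n with
  | zero => simp
  | succ n ih =>
    rw [ascPochhammer_succ_eval, ← mul_assoc, ← ih, Nat.cast_succ, ← add_assoc,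
      Real.Gamma_add_one (by positivity), mul_comm]

/-- Here `Γ(7/2) = (15/8) √π` and `3.5 ^ 3.5 = (343/16) √14`. -/
theorem rpow_div_Gamma_seven_halves :
    (3.5 : ℝ) ^ (3.5 : ℝ) / Real.Gamma 3.5 = 343 / 30 * √(14 / Real.pi) := by
  have h1 : Real.Gamma 3.5 = 15 / 8 * √Real.pi := by
    have h := Real.Gamma_nat_add_half 3
    norm_num [Nat.doubleFactorial] at h
    norm_num
    rw [h]
    ring
  have h2 : (3.5 : ℝ) ^ (3.5 : ℝ) = 343 / 16 * √14 := by
    have h14 : √(14 : ℝ) = 2 * √3.5 := by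
      rw [show (14 : ℝ) = 2 ^ 2 * 3.5 by norm_num, Real.sqrt_mul (by norm_num),
        Real.sqrt_sq (by norm_num)]
    rw [h14, Real.sqrt_eq_rpow, show (3.5 : ℝ) ^ (3.5 : ℝ) = 3.5 ^ ((3 : ℕ) + 1 / 2 : ℝ) by norm_num,
      Real.rpow_add (by norm_num), Real.rpow_natCast]
    norm_num
    ring
  have hp : √Real.pi ≠ 0 := (Real.sqrt_pos.2 Real.pi_pos).ne'
  rw [h1, h2, Real.sqrt_div (by norm_num)]
  field_simp
  norm_num

namespace Params

variable (p : Params)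

theorem helperPMF_pos (j : ℕ) : 0 < p.helperPMF j := by
  have := p.η_pos
  have h1 : 0 < Real.Gamma ((j : ℝ) + 3.5) := Real.Gamma_pos_of_pos (by positivity)
  have h2 : 0 < Real.Gamma (3.5 : ℝ) := Real.Gamma_pos_of_pos (by norm_num)
  unfold helperPMF
  positivity

/-- The tail of the law of the number of helpers as a hypergeometric function. -/
theorem tsum_helperPMF_add (i : ℕ) :
    ∑' n, p.helperPMF (i + n) = 343 / 30 * √(14 / Real.pi) *
      (Real.Gamma (i + 3.5) * p.η ^ i *
          ₂F₁ (1 : ℝ) ((i : ℝ) + 3.5) ((i : ℝ) + 1) (p.η / (p.η + 3.5)) /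
        ((Nat.factorial i : ℝ) * (p.η + 3.5) ^ ((i : ℝ) + 3.5))) := by
  have hη := p.η_pos
  have hη' : 0 < p.η + 3.5 := by linarith
  -- The term `n = 0` is factored out. What remains is a ratio of rising factorials, and the first
  -- parameter `1` cancels the `n!` of the hypergeometric series.
  have hterm : ∀ n, p.helperPMF (i + n) = (3.5 : ℝ) ^ (3.5 : ℝ) / Real.Gamma 3.5 *
      (Real.Gamma (i + 3.5) * p.η ^ i / ((Nat.factorial i : ℝ) * (p.η + 3.5) ^ ((i : ℝ) + 3.5))) *
      ((((Nat.factorial n : ℝ)⁻¹ * (ascPochhammer ℝ n).eval 1 *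
        (ascPochhammer ℝ n).eval ((i : ℝ) + 3.5) *
          ((ascPochhammer ℝ n).eval ((i : ℝ) + 1))⁻¹)) • (p.η / (p.η + 3.5)) ^ n) := by
    intro n
    have h1 : Real.Gamma (((i + n : ℕ) : ℝ) + 3.5) =
        Real.Gamma (i + 3.5) * (ascPochhammer ℝ n).eval ((i : ℝ) + 3.5) := by
      rw [← Gamma_add_natCast_eq (by positivity)]
      congr 1
      push_cast
      ring
    have h2 : ((i + n).factorial : ℝ) =
        (i.factorial : ℝ) * (ascPochhammer ℝ n).eval ((i : ℝ) + 1) := by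
      rw [← Real.Gamma_nat_eq_factorial, ← Real.Gamma_nat_eq_factorial,
        ← Gamma_add_natCast_eq (by positivity)]
      congr 1
      push_cast
      ring
    have h3 : (p.η + 3.5) ^ (((i + n : ℕ) : ℝ) + 3.5) =
        (p.η + 3.5) ^ ((i : ℝ) + 3.5) * (p.η + 3.5) ^ n := by
      rw [← Real.rpow_natCast, ← Real.rpow_add hη']
      congr 1
      push_cast
      ring
    have h4 : (ascPochhammer ℝ n).eval ((i : ℝ) + 1) ≠ 0 := fun h => by
      rw [h, mul_zero] at h2
      exact Nat.factorial_ne_zero _ (by exact_mod_cast h2)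
    have h5 : Real.Gamma (3.5 : ℝ) ≠ 0 := (Real.Gamma_pos_of_pos (by norm_num)).ne'
    have h6 : (i.factorial : ℝ) ≠ 0 := by exact_mod_cast Nat.factorial_ne_zero _
    have h7 : (n.factorial : ℝ) ≠ 0 := by exact_mod_cast Nat.factorial_ne_zero _
    have h8 : (p.η + 3.5) ^ ((i : ℝ) + 3.5) ≠ 0 := (Real.rpow_pos_of_pos hη' _).ne'
    rw [helperPMF, h1, h2, h3, ascPochhammer_eval_one, inv_mul_cancel₀ h7, one_mul, smul_eq_mul,
      div_pow, pow_add]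
    generalize (3.5 : ℝ) ^ (3.5 : ℝ) = A at *
    generalize Real.Gamma (3.5 : ℝ) = B at *
    generalize Real.Gamma ((i : ℝ) + 3.5) = C at *
    generalize (p.η + 3.5) ^ ((i : ℝ) + 3.5) = D at *
    generalize p.η + 3.5 = E at *
    field_simp
  simp_rw [hterm]
  rw [tsum_mul_left, rpow_div_Gamma_seven_halves, ordinaryHypergeometric_eq_tsum]
  ring

theorem pop_mem_Ioc {c : ℕ} (hc : c ∈ Finset.Icc 1 p.L) : p.pop c ∈ Ioc 0 1 := by
  have hpos : ∀ l ∈ Finset.Icc 1 p.L, 0 < (l : ℝ) ^ (-p.ζ) := fun l hl =>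
    Real.rpow_pos_of_pos (by exact_mod_cast (Finset.mem_Icc.1 hl).1) _
  have hle := Finset.single_le_sum (fun l hl => (hpos l hl).le) hc
  have h0 := (hpos c hc).trans_le hle
  refine ⟨mul_pos (inv_pos.2 h0) (hpos c hc), ?_⟩
  rw [pop, inv_mul_le_iff₀ h0, mul_one]
  exact hle

theorem hit_pos {c : ℕ} (hc : c ∈ Finset.Icc 1 p.L) : 0 < p.hit c := by
  have h := p.pop_mem_Ioc hc
  exact sub_pos.2 (pow_lt_one₀ (sub_nonneg.2 h.2) (sub_lt_self _ h.1) p.Cd_pos.ne')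

end Params

/-! ### Serving events, their probabilities and d2d coverage -/

namespace Network

variable {Ω : Type*} {p : Params} (X : Network Ω p)

/-- The event that none of the helpers with ranks in `J` stores content `c`. -/
def noneHas (J : Finset ℕ) (c : ℕ) : Set Ω := {ω | ∀ j ∈ J, ¬ X.Has j c ω}

theorem noneHas_eq_iInter (J : Finset ℕ) (c : ℕ) :
    X.noneHas J c = ⋂ im ∈ J ×ˢ (Finset.univ : Finset (Fin p.Cd)), X.slot im.1 im.2 ⁻¹' {c}ᶜ := by
  ext ω
  simp only [noneHas, Has, mem_ofPred_eq, mem_iInter, Finset.mem_product, Prod.forall,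
    Finset.mem_univ, and_true, mem_preimage, mem_compl_iff, mem_singleton_iff, not_exists]
  exact ⟨fun h j m hj => h j hj m, fun h j hj m => h j m hj⟩

theorem measurableSet_noneHas (J : Finset ℕ) (c : ℕ) :
    MeasurableSet[X.sigGroup {1}] (X.noneHas J c) := by
  rw [noneHas_eq_iInter]
  refine @Finset.measurableSet_biInter _ _ (X.sigGroup {1}) _ _ fun im _ => ?_
  exact X.measurable_slot_sigGroup (by simp) im.1 im.2 (measurableSet_singleton c).compl

/-- Written as a difference of nested "none has it" events, the content condition has as probability
a difference of two powers of the miss probability. -/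
theorem served_NS_eq {k c i : ℕ} (hi : i ∈ Finset.Icc 1 k) :
    X.served k c i .NS = X.atLeast i ∩
      (X.noneHas (Finset.Icc 1 (i - 1)) c \ X.noneHas (Finset.Icc 1 i) c) := by
  obtain ⟨h1, h2⟩ := Finset.mem_Icc.1 hi
  ext ω
  simp only [served, atLeast, noneHas, mem_ofPred_eq, mem_inter_iff, Set.mem_sdiff, Finset.mem_Icc]
  constructor
  · rintro ⟨-, h4, h5, h6⟩
    exact ⟨h4.trans (min_le_right _ _), fun j hj => h6 j hj.1 (by omega),
      fun h => h i ⟨h1, le_rfl⟩ h5⟩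
  · rintro ⟨h4, h5, h6⟩
    refine ⟨h1, le_min h2 h4, ?_, fun j hj1 hj2 => h5 j ⟨hj1, by omega⟩⟩
    by_contra h
    refine h6 fun j hj => ?_
    rcases hj.2.lt_or_eq with h' | rfl
    · exact h5 j ⟨hj.1, by omega⟩
    · exact h

/-- On a slice where `N` is constant the index of the draw `U` is deterministic, so independence can
be applied. -/
theorem served_US_eq {k c i : ℕ} (hi : i ∈ Finset.Icc 1 k) :
    X.served k c i .US = ⋃ n : ℕ, {ω | X.N ω = i + n} ∩
      (X.U (min k (i + n)) ⁻¹' {i} ∩ (X.noneHas {i} c)ᶜ) := by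
  obtain ⟨h1, h2⟩ := Finset.mem_Icc.1 hi
  ext ω
  simp only [served, noneHas, mem_ofPred_eq, mem_iUnion, mem_inter_iff, mem_compl_iff,
    mem_preimage, mem_singleton_iff, Finset.mem_singleton, forall_eq, not_not]
  constructor
  · rintro ⟨-, h4, h5, h6⟩
    have h7 : X.N ω = i + (X.N ω - i) := by
      have := h4.trans (min_le_right _ _)
      omega
    exact ⟨X.N ω - i, h7, by rw [← h7]; exact h5, h6⟩
  · rintro ⟨n, h4, h5, h6⟩
    exact ⟨h1, le_min h2 (by omega), by rw [h4]; exact h5, h6⟩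

theorem disjoint_served {k c i j : ℕ} (hij : i ≠ j) (S : Scheme) :
    Disjoint (X.served k c i S) (X.served k c j S) := by
  refine Set.disjoint_left.2 fun ω h1 h2 => ?_
  cases S
  · obtain ⟨a1, -, a3, a4⟩ := h1
    obtain ⟨b1, -, b3, b4⟩ := h2
    rcases lt_or_gt_of_ne hij with h | h
    · exact b4 i a1 h a3
    · exact a4 j b1 h b3
  · exact hij (h1.2.2.1.symm.trans h2.2.2.1)

theorem mem_Icc_of_mem_served {k c i : ℕ} {S : Scheme} {ω : Ω} (h : ω ∈ X.served k c i S) :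
    i ∈ Finset.Icc 1 k := by
  cases S <;> exact Finset.mem_Icc.2 ⟨h.1, h.2.1.trans (min_le_left _ _)⟩

theorem d2dMode_eq (k c : ℕ) (S : Scheme) :
    X.d2dMode k c S = ⋃ i ∈ Finset.Icc 1 k, X.served k c i S := by
  ext ω
  simp only [d2dMode, mem_ofPred_eq, mem_iUnion, exists_prop]
  exact exists_congr fun i => ⟨fun h => ⟨X.mem_Icc_of_mem_served h, h⟩, fun h => h.2⟩

theorem d2dCovered_eq (k c : ℕ) (S : Scheme) :
    X.d2dCovered k c S = ⋃ i ∈ Finset.Icc 1 k, X.served k c i S ∩ X.linkCovered i := by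
  ext ω
  simp only [d2dCovered, mem_ofPred_eq, mem_iUnion, exists_prop, mem_inter_iff]
  exact exists_congr fun i => ⟨fun h => ⟨X.mem_Icc_of_mem_served h.1, h⟩, fun h => h.2⟩

theorem measurableSet_sigGroup_N_inter {A : Set Ω}
    (hA : MeasurableSet[X.sigGroup {0, 3, 4, 5, 6}] A) (B : Set ℕ) :
    MeasurableSet[X.sigGroup {0, 3, 4, 5, 6}] ({ω | X.N ω ∈ B} ∩ A) :=
  @MeasurableSet.inter _ (X.sigGroup {0, 3, 4, 5, 6}) _ _
    (X.measurable_N_sigGroup (by simp) (MeasurableSet.of_discrete (s := B))) hA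

namespace IsModel

variable {X} [MeasurableSpace Ω] {P : Measure Ω}

theorem measurableSet_N_mem (hX : X.IsModel P) (B : Set ℕ) : MeasurableSet {ω | X.N ω ∈ B} :=
  hX.measurable_N (MeasurableSet.of_discrete (s := B))

theorem measurableSet_N_eq (hX : X.IsModel P) (n : ℕ) : MeasurableSet {ω | X.N ω = n} :=
  hX.measurableSet_N_mem {n}

theorem measurableSet_atLeast (hX : X.IsModel P) (i : ℕ) : MeasurableSet (X.atLeast i) :=
  hX.measurableSet_N_mem (Ici i)

theorem measure_atLeast (hX : X.IsModel P) (i : ℕ) :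
    P (X.atLeast i) = ∑' n, ENNReal.ofReal (p.helperPMF (i + n)) := by
  have h : X.atLeast i = ⋃ n, {ω | X.N ω = i + n} := by
    ext ω
    simp only [atLeast, mem_ofPred_eq, mem_iUnion]
    exact le_iff_exists_add
  rw [h, measure_iUnion (fun m n hmn => Set.disjoint_left.2 fun ω h1 h2 => hmn (by
    have h3 : X.N ω = i + m := h1
    have h4 : X.N ω = i + n := h2
    omega)) fun n => hX.measurableSet_N_eq (i + n)]
  exact tsum_congr fun n => hX.law_N _

/-- Summability is read off from the finiteness of `P`, with no estimate of Gamma functions. -/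
theorem summable_helperPMF_add [IsProbabilityMeasure P] (hX : X.IsModel P) (i : ℕ) :
    Summable fun n => p.helperPMF (i + n) := by
  have h : ∑' n, ENNReal.ofReal (p.helperPMF (i + n)) ≠ ⊤ := by
    rw [← hX.measure_atLeast]
    exact measure_ne_top _ _
  refine (ENNReal.summable_toReal h).congr fun n => ?_
  rw [ENNReal.toReal_ofReal (p.helperPMF_pos _).le]

theorem measureReal_atLeast [IsProbabilityMeasure P] (hX : X.IsModel P) (i : ℕ) :
    P.real (X.atLeast i) = ∑' n, p.helperPMF (i + n) := by
  rw [measureReal_def, hX.measure_atLeast, ← ENNReal.ofReal_tsum_of_nonneg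
    (fun n => (p.helperPMF_pos _).le) (hX.summable_helperPMF_add i),
    ENNReal.toReal_ofReal (tsum_nonneg fun n => (p.helperPMF_pos _).le)]

theorem measureReal_noneHas [IsProbabilityMeasure P] (hX : X.IsModel P) (J : Finset ℕ) {c : ℕ}
    (hc : c ∈ Finset.Icc 1 p.L) : P.real (X.noneHas J c) = (1 - p.hit c) ^ J.card := by
  have h1 : ∀ im : ℕ × Fin p.Cd, P.real (X.slot im.1 im.2 ⁻¹' {c}ᶜ) = 1 - p.pop c := by
    intro im
    rw [preimage_compl, probReal_compl_eq_one_sub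
      (hX.measurable_slot _ _ (measurableSet_singleton c)), measureReal_def]
    have := hX.law_slot im.1 im.2 c hc
    rw [show X.slot im.1 im.2 ⁻¹' {c} = {ω | X.slot im.1 im.2 ω = c} from rfl, this,
      ENNReal.toReal_ofReal (p.pop_mem_Ioc hc).1.le]
  rw [measureReal_def, noneHas_eq_iInter, hX.indep_slot.measure_inter_preimage_eq_mul
    (sets := fun _ => {c}ᶜ) _ fun _ _ => (measurableSet_singleton c).compl, ENNReal.toReal_prod]
  simp_rw [← measureReal_def, h1]
  rw [Finset.prod_const, Finset.card_product, Finset.card_univ, Fintype.card_fin, Params.hit,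
    sub_sub_cancel, ← pow_mul, mul_comm]

theorem measurableSet_noneHas (hX : X.IsModel P) (J : Finset ℕ) (c : ℕ) :
    MeasurableSet (X.noneHas J c) :=
  hX.sigGroup_le _ _ (X.measurableSet_noneHas J c)

theorem measurableSet_served (hX : X.IsModel P) {k c i : ℕ} (hi : i ∈ Finset.Icc 1 k)
    (S : Scheme) : MeasurableSet (X.served k c i S) := by
  cases S
  · rw [X.served_NS_eq hi]
    exact (hX.measurableSet_atLeast i).inter
      ((hX.measurableSet_noneHas _ _).diff (hX.measurableSet_noneHas _ _))
  · rw [X.served_US_eq hi]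
    exact MeasurableSet.iUnion fun n => (hX.measurableSet_N_eq (i + n)).inter
      ((hX.measurable_U _ (measurableSet_singleton i)).inter (hX.measurableSet_noneHas _ _).compl)

/-- Taking `A = univ` gives the serving probability, and `A = linkCovered i` the joint probability
with coverage. -/
theorem measureReal_served_NS_inter [IsProbabilityMeasure P] (hX : X.IsModel P) {k c i : ℕ}
    (hi : i ∈ Finset.Icc 1 k) (hc : c ∈ Finset.Icc 1 p.L) {A : Set Ω}
    (hA : MeasurableSet[X.sigGroup {0, 3, 4, 5, 6}] A) :
    P.real (X.served k c i .NS ∩ A) =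
      P.real (X.atLeast i ∩ A) * ((1 - p.hit c) ^ (i - 1) * p.hit c) := by
  obtain ⟨h1, h2⟩ := Finset.mem_Icc.1 hi
  have hind := (Indep_iff _ _ P).1 (hX.indep_sigGroup (S := {0, 3, 4, 5, 6}) (T := {1}) (by simp))
    _ _ (X.measurableSet_sigGroup_N_inter hA (Ici i)) (@MeasurableSet.diff _ (X.sigGroup {1}) _ _
      (X.measurableSet_noneHas (Finset.Icc 1 (i - 1)) c)
      (X.measurableSet_noneHas (Finset.Icc 1 i) c))
  have hsub : X.noneHas (Finset.Icc 1 i) c ⊆ X.noneHas (Finset.Icc 1 (i - 1)) c := fun ω h j hj => by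
    rw [Finset.mem_Icc] at hj
    exact h j (Finset.mem_Icc.2 ⟨hj.1, by omega⟩)
  have hdiff := measureReal_sdiff (μ := P) hsub (hX.measurableSet_noneHas _ _)
  rw [hX.measureReal_noneHas _ hc, hX.measureReal_noneHas _ hc, Nat.card_Icc, Nat.card_Icc,
    Nat.sub_add_cancel h1, Nat.add_sub_cancel] at hdiff
  rw [X.served_NS_eq hi, inter_right_comm, measureReal_def]
  refine (congrArg ENNReal.toReal hind).trans ?_
  rw [ENNReal.toReal_mul, ← measureReal_def, ← measureReal_def, hdiff]
  obtain ⟨m, rfl⟩ := Nat.exists_eq_add_of_le' h1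
  rw [Nat.add_sub_cancel, pow_succ]
  congr 1
  ring

/-- The weight `1 / min k (i + n)` varies with the slice, so unlike for NS the sum does not factor
through `atLeast i` for a general `A`. -/
theorem measure_served_US_inter [IsProbabilityMeasure P] (hX : X.IsModel P) {k c i : ℕ}
    (hi : i ∈ Finset.Icc 1 k) (hc : c ∈ Finset.Icc 1 p.L) {A : Set Ω}
    (hA : MeasurableSet[X.sigGroup {0, 3, 4, 5, 6}] A) :
    P (X.served k c i .US ∩ A) =
      ∑' n, P ({ω | X.N ω = i + n} ∩ A) *
        (((min k (i + n) : ℕ) : ℝ≥0∞)⁻¹ * ENNReal.ofReal (p.hit c)) := by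
  obtain ⟨h1, h2⟩ := Finset.mem_Icc.1 hi
  have hAm : MeasurableSet A := hX.sigGroup_le _ _ hA
  have hhas : P (X.noneHas {i} c)ᶜ = ENNReal.ofReal (p.hit c) := by
    rw [← ofReal_measureReal, probReal_compl_eq_one_sub (hX.measurableSet_noneHas _ _),
      hX.measureReal_noneHas _ hc]
    simp
  rw [X.served_US_eq hi, iUnion_inter, measure_iUnion]
  · refine tsum_congr fun n => ?_
    have hU : MeasurableSet[X.sigGroup {2}] (X.U (min k (i + n)) ⁻¹' {i}) :=
      X.measurable_U_sigGroup (by simp) _ (measurableSet_singleton i)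
    have hU' : MeasurableSet[X.sigGroup {1, 2}] (X.U (min k (i + n)) ⁻¹' {i}) :=
      X.measurable_U_sigGroup (by simp) _ (measurableSet_singleton i)
    have hS : MeasurableSet[X.sigGroup {1}] (X.noneHas {i} c)ᶜ :=
      @MeasurableSet.compl _ _ (X.sigGroup {1}) (X.measurableSet_noneHas _ _)
    have hS' : MeasurableSet[X.sigGroup {1, 2}] (X.noneHas {i} c)ᶜ :=
      biSup_mono (f := X.sig) (p := (· ∈ ({1} : Set (Fin 7)))) (q := (· ∈ ({1, 2} : Set (Fin 7))))
        (fun a ha => Or.inl ha) _ hS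
    have hind1 := (Indep_iff _ _ P).1 (hX.indep_sigGroup (S := {0, 3, 4, 5, 6}) (T := {1, 2})
      (by simp)) _ _ (X.measurableSet_sigGroup_N_inter hA {i + n})
      (@MeasurableSet.inter _ (X.sigGroup {1, 2}) _ _ hU' hS')
    have hind2 := (Indep_iff _ _ P).1 (hX.indep_sigGroup (S := {2}) (T := {1})
      (by simp)) _ _ hU hS
    have hlawU : P (X.U (min k (i + n)) ⁻¹' {i}) = ((min k (i + n) : ℕ) : ℝ≥0∞)⁻¹ :=
      hX.law_U _ i (Finset.mem_Icc.2 ⟨h1, le_min h2 (by omega)⟩)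
    rw [inter_right_comm]
    refine hind1.trans ?_
    rw [hind2, hlawU, hhas]
    rfl
  · intro m n hmn
    refine Set.disjoint_left.2 fun ω h3 h4 => hmn ?_
    have h5 : X.N ω = i + m := h3.1.1
    have h6 : X.N ω = i + n := h4.1.1
    omega
  · exact fun n => ((hX.measurableSet_N_eq (i + n)).inter
      ((hX.measurable_U _ (measurableSet_singleton i)).inter
        (hX.measurableSet_noneHas _ _).compl)).inter hAm

theorem measureReal_served_NS [IsProbabilityMeasure P] (hX : X.IsModel P) {k c i : ℕ}
    (hi : i ∈ Finset.Icc 1 k) (hc : c ∈ Finset.Icc 1 p.L) :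
    P.real (X.served k c i .NS) = p.pServe k i c .NS := by
  have h := hX.measureReal_served_NS_inter hi hc
    (@MeasurableSet.univ _ (X.sigGroup {0, 3, 4, 5, 6}))
  rw [inter_univ, inter_univ, hX.measureReal_atLeast, p.tsum_helperPMF_add] at h
  rw [h, Params.pServe]
  ring

theorem measureReal_served_US [IsProbabilityMeasure P] (hX : X.IsModel P) {k c i : ℕ}
    (hi : i ∈ Finset.Icc 1 k) (hc : c ∈ Finset.Icc 1 p.L) :
    P.real (X.served k c i .US) = p.pServe k i c .US := by
  obtain ⟨h1, h2⟩ := Finset.mem_Icc.1 hi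
  have h := hX.measure_served_US_inter hi hc
    (@MeasurableSet.univ _ (X.sigGroup {0, 3, 4, 5, 6}))
  simp_rw [inter_univ, hX.law_N] at h
  have hh := (p.hit_pos hc).le
  have hterm : ∀ n, ENNReal.ofReal (p.helperPMF (i + n)) *
      (((min k (i + n) : ℕ) : ℝ≥0∞)⁻¹ * ENNReal.ofReal (p.hit c)) =
      ENNReal.ofReal (p.hit c * (p.helperPMF (i + n) / (min k (i + n) : ℕ))) := by
    intro n
    have hpos : (0 : ℝ) < (min k (i + n) : ℕ) := by
      have : 0 < min k (i + n) := lt_min (by omega) (by omega)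
      exact_mod_cast this
    rw [← ENNReal.ofReal_natCast, ← ENNReal.ofReal_inv_of_pos hpos,
      ← ENNReal.ofReal_mul (inv_nonneg.2 hpos.le), ← ENNReal.ofReal_mul (p.helperPMF_pos _).le]
    congr 1
    ring
  have hnn : ∀ n, 0 ≤ p.hit c * (p.helperPMF (i + n) / (min k (i + n) : ℕ)) := fun n =>
    mul_nonneg hh (div_nonneg (p.helperPMF_pos _).le (Nat.cast_nonneg _))
  have hsum : Summable fun n => p.helperPMF (i + n) / (min k (i + n) : ℕ) := by
    refine Summable.of_nonneg_of_le (fun n => div_nonneg (p.helperPMF_pos _).le (Nat.cast_nonneg _))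
      (fun n => ?_) (hX.summable_helperPMF_add i)
    refine div_le_self (p.helperPMF_pos _).le ?_
    have : 1 ≤ min k (i + n) := le_min (by omega) (by omega)
    exact_mod_cast this
  simp_rw [hterm] at h
  -- The series splits after `N = k`: up to there all `i + j` helpers are candidates, and beyond it
  -- the weight is constantly `1 / k`, leaving a pure tail of the law of `N`.
  rw [measureReal_def, h, ← ENNReal.ofReal_tsum_of_nonneg hnn (hsum.mul_left _),
    ENNReal.toReal_ofReal (tsum_nonneg hnn), tsum_mul_left, ← hsum.sum_add_tsum_nat_add (k - i + 1),
    Params.pServe]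
  congr 1
  rw [add_comm]
  congr 1
  · have htail : ∀ n, p.helperPMF (i + (n + (k - i + 1))) / (min k (i + (n + (k - i + 1))) : ℕ) =
        p.helperPMF (k + 1 + n) / k := by
      intro n
      rw [show i + (n + (k - i + 1)) = k + 1 + n by omega, min_eq_left (by omega)]
    simp_rw [htail]
    rw [tsum_div_const, p.tsum_helperPMF_add]
    push_cast
    rw [show (k : ℝ) + 1 + 3.5 = k + 4.5 by ring, show (k : ℝ) + 1 + 1 = k + 2 by ring]
    ring
  · refine Finset.sum_congr rfl fun j hj => ?_
    rw [min_eq_right (by have := Finset.mem_range.1 hj; omega), Params.helperPMF, div_div]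
    congr 1
    ring

theorem measureReal_served [IsProbabilityMeasure P] (hX : X.IsModel P) {k c i : ℕ}
    (hi : i ∈ Finset.Icc 1 k) (hc : c ∈ Finset.Icc 1 p.L) (S : Scheme) :
    P.real (X.served k c i S) = p.pServe k i c S := by
  cases S
  exacts [hX.measureReal_served_NS hi hc, hX.measureReal_served_US hi hc]

/-- Being served by the `i`-th nearest helper does not influence the quality of its link. -/
theorem measureReal_served_inter_linkCovered [IsProbabilityMeasure P] (hX : X.IsModel P)
    {k c i : ℕ} (hi : i ∈ Finset.Icc 1 k) (hc : c ∈ Finset.Icc 1 p.L) (S : Scheme)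
    (hUS : S = .US → ∀ n, i ≤ n → (cond P {ω | X.N ω = n}).map (X.R i) =
      (cond P (X.atLeast i)).map (X.R i)) :
    P.real (X.served k c i S ∩ X.linkCovered i) = P.real (X.served k c i S) * X.linkCov P i := by
  cases S
  · have h := hX.measureReal_served_NS_inter hi hc
      (@MeasurableSet.univ _ (X.sigGroup {0, 3, 4, 5, 6}))
    rw [inter_univ, inter_univ] at h
    rw [hX.measureReal_served_NS_inter hi hc (X.measurableSet_linkCovered_sigGroup i), h,
      measureReal_def (s := X.atLeast i ∩ _), ← cond_mul_eq_inter (hX.measurableSet_atLeast i),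
      ENNReal.toReal_mul, linkCov, ← measureReal_def, ← measureReal_def]
    ring
  · have h := hX.measure_served_US_inter hi hc
      (@MeasurableSet.univ _ (X.sigGroup {0, 3, 4, 5, 6}))
    simp_rw [inter_univ] at h
    -- The assumed common conditional law of `R i` makes the coverage equal on all slices, so it
    -- comes out of the weighted sum.
    have hn : ∀ n, P ({ω | X.N ω = i + n} ∩ X.linkCovered i) =
        P {ω | X.N ω = i + n} * (cond P (X.atLeast i)) (X.linkCovered i) := by
      intro n
      have h1 := hX.cond_linkCovered i {i + n}
      have h2 := hX.cond_linkCovered i (Ici i)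
      simp only [mem_singleton_iff, mem_Ici] at h1 h2
      rw [← cond_mul_eq_inter (hX.measurableSet_N_eq (i + n)), mul_comm]
      congr 1
      refine h1.trans ?_
      rw [hUS rfl (i + n) (Nat.le_add_right _ _)]
      exact h2.symm
    rw [measureReal_def, measureReal_def, linkCov, measureReal_def, ← ENNReal.toReal_mul,
      hX.measure_served_US_inter hi hc (X.measurableSet_linkCovered_sigGroup i), h,
      ← ENNReal.tsum_mul_right]
    congr 1
    refine tsum_congr fun n => ?_
    rw [hn]
    ring

theorem pServe_nonneg [IsProbabilityMeasure P] (hX : X.IsModel P) {k c i : ℕ}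
    (hi : i ∈ Finset.Icc 1 k) (hc : c ∈ Finset.Icc 1 p.L) (S : Scheme) :
    0 ≤ p.pServe k i c S := by
  rw [← hX.measureReal_served hi hc]
  exact measureReal_nonneg

/-- Rank one suffices to make the sum positive. Under NS higher ranks can have probability zero: if
`L = 1`, the nearest helper always has the content. -/
theorem pServe_one_pos [IsProbabilityMeasure P] (hX : X.IsModel P) {k c : ℕ} (hk : 1 ≤ k)
    (hc : c ∈ Finset.Icc 1 p.L) (S : Scheme) : 0 < p.pServe k 1 c S := by
  have hi : 1 ∈ Finset.Icc 1 k := Finset.mem_Icc.2 ⟨le_rfl, hk⟩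
  cases S
  · have h := hX.measureReal_served_NS_inter hi hc
      (@MeasurableSet.univ _ (X.sigGroup {0, 3, 4, 5, 6}))
    rw [inter_univ, inter_univ, hX.measureReal_served_NS hi hc, hX.measureReal_atLeast] at h
    rw [h, Nat.sub_self, pow_zero, one_mul]
    exact mul_pos ((hX.summable_helperPMF_add 1).tsum_pos (fun n => (p.helperPMF_pos _).le) 0
      (p.helperPMF_pos _)) (p.hit_pos hc)
  · rw [← hX.measureReal_served_US hi hc, measureReal_def]
    refine ENNReal.toReal_pos (ne_of_gt ?_) (measure_ne_top _ _)
    have h := hX.measure_served_US_inter hi hc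
      (@MeasurableSet.univ _ (X.sigGroup {0, 3, 4, 5, 6}))
    simp_rw [inter_univ, hX.law_N] at h
    rw [h]
    refine lt_of_lt_of_le ?_ (ENNReal.le_tsum 0)
    exact ENNReal.mul_pos (by simpa using p.helperPMF_pos _)
      (mul_ne_zero (by simp) (by simpa using p.hit_pos hc))

theorem sum_pServe_pos [IsProbabilityMeasure P] (hX : X.IsModel P) {k c : ℕ} (hk : 1 ≤ k)
    (hc : c ∈ Finset.Icc 1 p.L) (S : Scheme) : 0 < ∑ i ∈ Finset.Icc 1 k, p.pServe k i c S :=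
  Finset.sum_pos' (fun _ hi => hX.pServe_nonneg hi hc S)
    ⟨1, Finset.mem_Icc.2 ⟨le_rfl, hk⟩, hX.pServe_one_pos hk hc S⟩

theorem d2dCov_eq [IsProbabilityMeasure P] (hX : X.IsModel P) {k c : ℕ}
    (hc : c ∈ Finset.Icc 1 p.L) (S : Scheme)
    (hUS : S = .US → ∀ i ∈ Finset.Icc 1 k, ∀ n, i ≤ n →
      (cond P {ω | X.N ω = n}).map (X.R i) = (cond P (X.atLeast i)).map (X.R i)) :
    X.d2dCov P k c S = (∑ i ∈ Finset.Icc 1 k, p.pServe k i c S * X.linkCov P i) /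
      ∑ i ∈ Finset.Icc 1 k, p.pServe k i c S := by
  have hmode : P.real (X.d2dMode k c S) = ∑ i ∈ Finset.Icc 1 k, p.pServe k i c S := by
    rw [X.d2dMode_eq, measureReal_biUnion_finset (fun i _ j _ hij => X.disjoint_served hij S)
      fun i hi => hX.measurableSet_served hi S]
    exact Finset.sum_congr rfl fun i hi => hX.measureReal_served hi hc S
  have hcov : P.real (X.d2dCovered k c S) =
      ∑ i ∈ Finset.Icc 1 k, p.pServe k i c S * X.linkCov P i := by
    rw [X.d2dCovered_eq, measureReal_biUnion_finset
      (fun i _ j _ hij => (X.disjoint_served hij S).mono inter_subset_left inter_subset_left)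
      fun i hi => (hX.measurableSet_served hi S).inter (hX.measurableSet_linkCovered i)]
    refine Finset.sum_congr rfl fun i hi => ?_
    rw [hX.measureReal_served_inter_linkCovered hi hc S fun h => hUS h i hi,
      hX.measureReal_served hi hc S]
  have hmm : MeasurableSet (X.d2dMode k c S) := by
    rw [X.d2dMode_eq]
    exact Finset.measurableSet_biUnion _ fun i hi => hX.measurableSet_served hi S
  have hsub : X.d2dCovered k c S ⊆ X.d2dMode k c S := fun ω ⟨i, h, _⟩ => ⟨i, h⟩
  rw [d2dCov, measureReal_def, cond_apply hmm, ENNReal.toReal_mul, ENNReal.toReal_inv,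
    ← measureReal_def, ← measureReal_def, inter_eq_right.2 hsub, hmode, hcov, div_eq_inv_mul]

end IsModel

end Network

end D2D

end

/-! ### The combined statement on serving probabilities and coverage -/

theorem mainTheorem7 {Ω : Type*} [MeasurableSpace Ω] (P : MeasureTheory.Measure Ω)
    [MeasureTheory.IsProbabilityMeasure P] (p : D2D.Params) (X : D2D.Network Ω p)
    (hX : X.IsModel P) (S : D2D.Scheme) (k c : ℕ) (hk : 1 ≤ k) (hc : c ∈ Finset.Icc 1 p.L)
    (f : ℕ → ℝ → ℝ)
    (hf_meas : ∀ i ∈ Finset.Icc 1 k, Measurable (f i))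
    (hf_nonneg : ∀ i ∈ Finset.Icc 1 k, ∀ r, 0 ≤ f i r)
    (hf_law : ∀ i ∈ Finset.Icc 1 k,
      (ProbabilityTheory.cond P (X.atLeast i)).map (X.R i) =
        (MeasureTheory.volume.restrict (Set.Ioi (0 : ℝ))).withDensity
          fun r => ENNReal.ofReal (f i r))
    (hUS : S = D2D.Scheme.US → ∀ i ∈ Finset.Icc 1 k, ∀ n, i ≤ n →
      (ProbabilityTheory.cond P {ω | X.N ω = n}).map (X.R i) =
        (ProbabilityTheory.cond P (X.atLeast i)).map (X.R i)) :
    (∀ i ∈ Finset.Icc 1 k, P.real (X.served k c i S) = p.pServe k i c S ∧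
      (0 < p.pServe k i c S →
        (ProbabilityTheory.cond P (X.served k c i S)).real (X.linkCovered i) = X.linkCov P i)) ∧
    0 < ∑ i ∈ Finset.Icc 1 k, p.pServe k i c S ∧
    X.d2dCov P k c S =
      (∑ i ∈ Finset.Icc 1 k, p.pServe k i c S * X.linkCov P i) /
        ∑ i ∈ Finset.Icc 1 k, p.pServe k i c S ∧
    (∀ s : ℝ, 0 < s → MeasureTheory.IntegrableOn (fun q => p.deltaKernel s q * p.fQ q)
      (Set.Ioi (0 : ℝ))) ∧
    ∀ i ∈ Finset.Icc 1 k,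
      MeasureTheory.IntegrableOn (p.covIntegrand (f i)) (Set.Ioi (0 : ℝ)) ∧
      ∫ r in Set.Ioi (0 : ℝ), p.covIntegrand (f i) r ≤ X.linkCov P i ∧
      X.linkCov P i ≤ (∫ r in Set.Ioi (0 : ℝ), p.covIntegrand (f i) r) +
        ∫ r in Set.Ioi (0 : ℝ), p.errIntegrand (f i) r := by
  refine ⟨fun i hi => ⟨hX.measureReal_served hi hc S, fun hpos => ?_⟩, hX.sum_pServe_pos hk hc S,
    hX.d2dCov_eq hc S hUS, fun s hs => hX.integrableOn_deltaKernel_mul_fQ hs,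
    fun i hi => hX.linkCov_bounds i (hf_meas i hi) (hf_nonneg i hi) (hf_law i hi)⟩
  rw [MeasureTheory.measureReal_def, ProbabilityTheory.cond_apply (hX.measurableSet_served hi S),
    ENNReal.toReal_mul, ENNReal.toReal_inv, ← MeasureTheory.measureReal_def,
    ← MeasureTheory.measureReal_def,
    hX.measureReal_served_inter_linkCovered hi hc S fun h => hUS h i hi,
    hX.measureReal_served hi hc S, inv_mul_cancel_left₀ hpos.ne']
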